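/- Let $U\subset\mathbb R^2$ be open, let $f:U\to\mathbb R^3$ be a front with smooth unit normal vector field $\nu$ (that is, $f$ and $\nu$ are $C^\infty$, $|\nu|=1$, $\langle df(X),\nu\rangle=0$ for all tangent vectors $X$, and $(f,\nu)$ is an immersion), and let $f$ have a cuspidal edge at $p\in U$, i.e. the germ of $f$ at $p$ is equivalent, by $C^\infty$ diffeomorphism germs of source and target, to the germ of $(u,v)\mapsto(u,v^2,v^3)$ at $0$. Let $c\in\mathbb R^3$ be a constant vector with $\langle f(p)+c,\nu(p)\rangle\neq0$ and let $f^*=\langle f+c,\nu\rangle\,\nu$ be the dual surface of $f$. Call coordinates $(u,v)$ on a neighbourhood of $p$ in $U$, centred at $p$, *adapted* if the singular points of $f$ in it are exactly the points of the $u$-axis and $f_v=0$ on the $u$-axis. In such coordinates there is a unique smooth $\psi$ with $f_v=v\psi$; put $$\hat E=\langle f_u,f_u\rangle,\quad \hat F=\langle f_u,\psi\rangle,\quad \hat G=\langle\psi,\psi\rangle,\quad \hat L=-\langle f_u,\nu_u\rangle,\quad \hat M=-\langle\psi,\nu_u\rangle,\quad \hat N=-\langle\psi,\nu_v\rangle,$$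 $$\hat A=\hat E\hat N-2v\hat F\hat M+v\hat G\hat L,\qquad \hat B=\sqrt{\hat A^2-4v(\hat E\hat G-\hat F^2)(\hat L\hat N-v\hat M^2)}.$$ If $\hat N>0$ on the $u$-axis, the principal curvature $$\hat\kappa_2=\frac{\hat A-\hat B}{2v(\hat E\hat G-\hat F^2)}=\frac{2(\hat L\hat N-v\hat M^2)}{\hat A+\hat B}$$ (the second expression being used on the $u$-axis) is smooth near $p$, and $p$ is called a *ridge point* of $f$ if the derivative of $\hat\kappa_2$ at $p$ in the principal direction $\hat{\boldsymbol v}=(\hat N-v\hat\kappa_2\hat G)\,\partial_u+(-\hat M+\hat\kappa_2\hat F)\,\partial_v$ vanishes. Then adapted coordinates centred at $p$ with $\hat N>0$ on the $u$-axis exist, and for all such coordinates: $f^*$ has a cuspidal edge at $p$ if and only if $\hat\kappa_2(p)=0$ and $p$ is not a ridge point of $f$. -/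

import Mathlib

open scoped ContDiff Topology

noncomputable section

namespace CuspidalEdge

/-- Euclidean 3-space. -/
abbrev E3 : Type := EuclideanSpace ℝ (Fin 3)

/-! ### Germs and cuspidal edges -/

/-- `φ` is a smooth diffeomorphism between its (open) source and its (open) target. -/
def IsSmoothDiffeo {E F : Type*} [NormedAddCommGroup E] [NormedSpace ℝ E]
    [NormedAddCommGroup F] [NormedSpace ℝ F] (φ : OpenPartialHomeomorph E F) : Prop :=
  ContDiffOn ℝ ∞ φ φ.source ∧ ContDiffOn ℝ ∞ φ.symm φ.target

/-- The germ of `f` at `p` is `𝒜`-equivalent to the germ of `g` at `q`: there are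
diffeomorphism germs `Φs : (ℝ², p) → (ℝ², q)` and `Φt : (ℝ³, f p) → (ℝ³, g q)` with
`Φt ∘ f = g ∘ Φs` near `p`. -/
def AEquivAt (f : ℝ × ℝ → E3) (p : ℝ × ℝ) (g : ℝ × ℝ → E3) (q : ℝ × ℝ) : Prop :=
  ∃ (Φs : OpenPartialHomeomorph (ℝ × ℝ) (ℝ × ℝ)) (Φt : OpenPartialHomeomorph E3 E3),
    IsSmoothDiffeo Φs ∧ IsSmoothDiffeo Φt ∧
    p ∈ Φs.source ∧ Φs p = q ∧ f p ∈ Φt.source ∧ Φt (f p) = g q ∧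
    ∀ᶠ x in 𝓝 p, f x ∈ Φt.source ∧ Φt (f x) = g (Φs x)

/-- The standard cuspidal edge `(u, v) ↦ (u, v², v³)`. -/
def standardCuspidalEdge (x : ℝ × ℝ) : E3 := !₂[x.1, x.2 ^ 2, x.2 ^ 3]

/-- `f` has a cuspidal edge at `p`. -/
def HasCuspidalEdgeAt (f : ℝ × ℝ → E3) (p : ℝ × ℝ) : Prop :=
  AEquivAt f p standardCuspidalEdge 0

/-! ### Fronts and dual surfaces -/

/-- `f` is a front on `U` with unit normal vector field `ν`. -/
structure IsFrontOn (U : Set (ℝ × ℝ)) (f ν : ℝ × ℝ → E3) : Prop where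
  smooth : ContDiffOn ℝ ∞ f U
  smooth_normal : ContDiffOn ℝ ∞ ν U
  norm_normal : ∀ x ∈ U, ‖ν x‖ = 1
  orthogonal : ∀ x ∈ U, ∀ w : ℝ × ℝ, inner ℝ (fderiv ℝ f x w) (ν x) = 0
  immersion : ∀ x ∈ U, Function.Injective (fderiv ℝ (fun y => (f y, ν y)) x)

/-- The dual surface `f* = ⟨f + c, ν⟩ ν`. -/
def dualSurface (f ν : ℝ × ℝ → E3) (c : E3) (x : ℝ × ℝ) : E3 :=
  (inner ℝ (f x + c) (ν x)) • ν x

/-! ### The functions attached to an adapted coordinate system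

Below `g` and `n` are the map and its unit normal field written in coordinates `(u, v)`. -/

section Coordinates

variable {E : Type*} [NormedAddCommGroup E] [NormedSpace ℝ E]

/-- The partial derivative `∂h/∂u`. -/
def du (h : ℝ × ℝ → E) (x : ℝ × ℝ) : E := fderiv ℝ h x (1, 0)

/-- The partial derivative `∂h/∂v`. -/
def dv (h : ℝ × ℝ → E) (x : ℝ × ℝ) : E := fderiv ℝ h x (0, 1)

end Coordinates

/-- The map `ψ` with `g_v = v ψ`. Where `g_v` vanishes on the `u`-axis, its smooth extension to
the `u`-axis has the value `g_vv`. -/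
def psi (g : ℝ × ℝ → E3) (x : ℝ × ℝ) : E3 :=
  if x.2 = 0 then dv (dv g) x else x.2⁻¹ • dv g x

def hatE (g : ℝ × ℝ → E3) (x : ℝ × ℝ) : ℝ := inner ℝ (du g x) (du g x)

def hatF (g : ℝ × ℝ → E3) (x : ℝ × ℝ) : ℝ := inner ℝ (du g x) (psi g x)

def hatG (g : ℝ × ℝ → E3) (x : ℝ × ℝ) : ℝ := inner ℝ (psi g x) (psi g x)

def hatL (g n : ℝ × ℝ → E3) (x : ℝ × ℝ) : ℝ := -inner ℝ (du g x) (du n x)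

def hatM (g n : ℝ × ℝ → E3) (x : ℝ × ℝ) : ℝ := -inner ℝ (psi g x) (du n x)

def hatN (g n : ℝ × ℝ → E3) (x : ℝ × ℝ) : ℝ := -inner ℝ (psi g x) (dv n x)

def hatA (g n : ℝ × ℝ → E3) (x : ℝ × ℝ) : ℝ :=
  hatE g x * hatN g n x - 2 * x.2 * hatF g x * hatM g n x + x.2 * hatG g x * hatL g n x

def hatB (g n : ℝ × ℝ → E3) (x : ℝ × ℝ) : ℝ :=
  √(hatA g n x ^ 2 - 4 * x.2 * (hatE g x * hatG g x - hatF g x ^ 2) *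
    (hatL g n x * hatN g n x - x.2 * hatM g n x ^ 2))

/-- The principal curvature `κ̂₂ = (Â - B̂) / (2 v (ÊĜ - F̂²))` off the `u`-axis. The equal
expression `2 (L̂N̂ - v M̂²) / (Â + B̂)` gives its smooth extension to the `u`-axis
when `N̂ > 0` there. -/
def hatKappa₂ (g n : ℝ × ℝ → E3) (x : ℝ × ℝ) : ℝ :=
  if x.2 = 0 then
    2 * (hatL g n x * hatN g n x - x.2 * hatM g n x ^ 2) / (hatA g n x + hatB g n x)
  else
    (hatA g n x - hatB g n x) / (2 * x.2 * (hatE g x * hatG g x - hatF g x ^ 2))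

/-- The principal direction `v̂ = (N̂ - v κ̂₂ Ĝ, -M̂ + κ̂₂ F̂)` belonging to `κ̂₂`. -/
def hatDirection (g n : ℝ × ℝ → E3) (x : ℝ × ℝ) : ℝ × ℝ :=
  (hatN g n x - x.2 * hatKappa₂ g n x * hatG g x, -hatM g n x + hatKappa₂ g n x * hatF g x)

/-- The point `x` is a ridge point: the derivative of `κ̂₂` in the direction `v̂` is zero. -/
def IsRidgePoint (g n : ℝ × ℝ → E3) (x : ℝ × ℝ) : Prop :=
  fderiv ℝ (hatKappa₂ g n) x (hatDirection g n x) = 0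

/-! ### Adapted coordinate systems -/

/-- `x` is a singular point of `g`: `g` is not an immersion at `x`. -/
def IsSingularPoint (g : ℝ × ℝ → E3) (x : ℝ × ℝ) : Prop :=
  ¬ Function.Injective (fderiv ℝ g x)

/-- The local parametrization `(u, v) ↦ φ (u, v)` of a neighbourhood of `p` in `U` is an adapted
coordinate system of `f` centred at `p`, in which `N̂` is positive on the `u`-axis. -/
structure IsAdapted (U : Set (ℝ × ℝ)) (f ν : ℝ × ℝ → E3) (p : ℝ × ℝ)
    (φ : OpenPartialHomeomorph (ℝ × ℝ) (ℝ × ℝ)) : Prop where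
  diffeo : IsSmoothDiffeo φ
  target_subset : φ.target ⊆ U
  zero_mem : (0 : ℝ × ℝ) ∈ φ.source
  map_zero : φ 0 = p
  /-- The singular points are exactly the points of the `u`-axis. -/
  singular_iff : ∀ x ∈ φ.source, IsSingularPoint (f ∘ φ) x ↔ x.2 = 0
  /-- `∂/∂v` is a null vector field on the `u`-axis. -/
  null : ∀ x ∈ φ.source, x.2 = 0 → dv (f ∘ φ) x = 0
  hatN_pos : ∀ x ∈ φ.source, x.2 = 0 → 0 < hatN (f ∘ φ) (ν ∘ φ) x

end CuspidalEdge

end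

noncomputable section

namespace CuspidalEdge

open Set Filter MeasureTheory

/-! ### Smooth dependence of integrals on parameters -/

-- Write `F`, `n` for the front and its normal in adapted coordinates, `h = ⟨F + c, n⟩` and `η =
-- (N̂, -M̂)` with entries taken at the origin. Since `|n| = 1`, the dual surface `h n` is carried
-- by inversion in the unit sphere to the polar dual `G = n / h`. Inversion is a local
-- diffeomorphism away from the origin, so `G` may replace the dual surface.
--
-- The gain is a duality: `⟨G, F + c⟩ = 1` and `⟨dF, G⟩ = 0` give `⟨dG, F + c⟩ = 0`, so `F + c` is a
-- normal field of `G`. At the origin `ψ`, `F_u`, `F + c` form a frame, and pairing with it gives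
-- `⟨dG(w), F_u⟩ = -w₁ L̂ / h` and `⟨dG(w), ψ⟩ = -(w₁ M̂ + w₂ N̂) / h`. As `N̂ ≠ 0`, `G` is singular
-- exactly when `L̂ = 0`, and then `η` spans the kernel. One more derivative gives `⟨D²G(η, η), F_u⟩
-- = -dK(η) / h` with `K = L̂ N̂ - v M̂²`. On the other side `κ̂₂ = 2K / (Â + B̂)` with `Â + B̂ ≠
-- 0`, so `κ̂₂ = 0` means `L̂ = 0`, and in that case the ridge derivative is a nonzero multiple of
-- `dK(η)` (`hatKappa₂_condition_iff`).
--
-- It remains to see that a cuspidal edge of `G` amounts to corank one with `D²G(η, η)` outside the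
-- image of `dG`. Necessity is invariance of second-order data under `𝒜`-equivalence
-- (`AEquivAt.corank_one`). Sufficiency is `aequivAt_standard_of_coordinates`: the components `X, Y,
-- Z` of `G` along the frame satisfy `dZ = r dX + s dY` with `ds(η) ≠ 0`, because the normal `F + c`
-- turns along `η`. Source and target changes normalise `(X, Y)` to `(u, v²)`. Then `Z_v` is
-- divisible by `v`, so `Z = A(u, v²) + v³ B(u, v²)` with `B(0) ≠ 0`, and a target change removes
-- `A` and `B`. The splitting uses Whitney's theorem on even functions, obtained from a reflection
-- series of Seeley type (`IsEvenTest.exists_comp_sq`).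

universe u in
theorem contDiff_intervalIntegral {E G : Type u} [NormedAddCommGroup E] [NormedSpace ℝ E]
    [ProperSpace E] [NormedAddCommGroup G] [NormedSpace ℝ G] [CompleteSpace G]
    {F : E × ℝ → G} (hF : ContDiff ℝ ∞ F) :
    ContDiff ℝ ∞ (fun x => ∫ t in (0 : ℝ)..1, F (x, t)) := by
  rw [contDiff_infty]
  intro n
  -- The derivative is an integral of the same kind with values in `E →L[ℝ] G`; this is why the
  -- target varies in the induction and why `E` and `G` share a universe.
  induction n generalizing G with
  | zero =>
    rw [Nat.cast_zero, contDiff_zero]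
    exact intervalIntegral.continuous_parametric_intervalIntegral_of_continuous'
      (f := fun x t => F (x, t)) (by simpa [Function.uncurry_def] using hF.continuous) 0 1
  | succ n ih =>
    rw [Nat.cast_succ, contDiff_succ_iff_hasFDerivAt]
    have hF' : ContDiff ℝ ∞ (fun z : E × ℝ =>
        (fderiv ℝ F z).comp (ContinuousLinearMap.inl ℝ E ℝ)) :=
      (hF.fderiv_right (m := ∞) le_rfl).clm_comp contDiff_const
    refine ⟨_, ih hF', fun x₀ => ?_⟩
    obtain ⟨C, hC⟩ := ((isCompact_closedBall x₀ 1).prod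
      (isCompact_Icc (a := (0 : ℝ)) (b := 1))).exists_bound_of_continuousOn hF'.continuous.continuousOn
    refine intervalIntegral.hasFDerivAt_integral_of_dominated_of_fderiv_le
      (F := fun x t => F (x, t)) (bound := fun _ => C) (s := Metric.closedBall x₀ 1)
      (F' := fun x t => (fderiv ℝ F (x, t)).comp (ContinuousLinearMap.inl ℝ E ℝ))
      (Metric.closedBall_mem_nhds _ one_pos) ?_ ?_ ?_ ?_ ?_ ?_
    · exact Eventually.of_forall fun x =>
        (hF.continuous.comp (by fun_prop : Continuous fun t : ℝ => (x, t))).aestronglyMeasurable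
    · exact (hF.continuous.comp
        (by fun_prop : Continuous fun t : ℝ => (x₀, t))).intervalIntegrable _ _
    · exact (hF'.continuous.comp
        (by fun_prop : Continuous fun t : ℝ => (x₀, t))).aestronglyMeasurable
    · refine Eventually.of_forall fun t ht x hx => hC (x, t) ⟨hx, ?_⟩
      rw [uIoc_of_le zero_le_one] at ht
      exact ⟨ht.1.le, ht.2⟩
    · exact intervalIntegrable_const
    · refine Eventually.of_forall fun t _ x _ => ?_
      exact ((hF.differentiable (by simp)) (x, t)).hasFDerivAt.comp x
        (hasFDerivAt_prodMk_left x t)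

/-! ### Division by the second coordinate -/

section Division

variable {E : Type} [NormedAddCommGroup E] [NormedSpace ℝ E]

/-- The Hadamard quotient `(h (u, v) - h (u, 0)) / v`. -/
def divSnd (h : ℝ × ℝ → E) (x : ℝ × ℝ) : E :=
  ∫ t in (0 : ℝ)..1, dv h (x.1, t * x.2)

theorem contDiff_du {h : ℝ × ℝ → E} (hh : ContDiff ℝ ∞ h) : ContDiff ℝ ∞ (du h) :=
  (hh.fderiv_right (m := ∞) le_rfl).clm_apply contDiff_const

theorem contDiff_dv {h : ℝ × ℝ → E} (hh : ContDiff ℝ ∞ h) : ContDiff ℝ ∞ (dv h) :=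
  (hh.fderiv_right (m := ∞) le_rfl).clm_apply contDiff_const

theorem hasDerivAt_snd_line {h : ℝ × ℝ → E} {x : ℝ × ℝ} (hh : DifferentiableAt ℝ h x) :
    HasDerivAt (fun v => h (x.1, v)) (dv h x) x.2 :=
  HasFDerivAt.comp_hasDerivAt (l := h) (f := fun v => (x.1, v)) x.2 hh.hasFDerivAt
    ((hasDerivAt_const x.2 x.1).prodMk (hasDerivAt_id x.2))

theorem hasDerivAt_fst_line {h : ℝ × ℝ → E} {x : ℝ × ℝ} (hh : DifferentiableAt ℝ h x) :
    HasDerivAt (fun v => h (v, x.2)) (du h x) x.1 :=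
  HasFDerivAt.comp_hasDerivAt (l := h) (f := fun v => (v, x.2)) x.1 hh.hasFDerivAt
    ((hasDerivAt_id x.1).prodMk (hasDerivAt_const x.1 x.2))

theorem divSnd_axis [CompleteSpace E] (h : ℝ × ℝ → E) (a : ℝ) :
    divSnd h (a, 0) = dv h (a, 0) := by
  simp [divSnd]

variable [CompleteSpace E]

theorem contDiff_divSnd {h : ℝ × ℝ → E} (hh : ContDiff ℝ ∞ h) : ContDiff ℝ ∞ (divSnd h) := by
  have : ContDiff ℝ ∞ (fun z : (ℝ × ℝ) × ℝ => dv h (z.1.1, z.2 * z.1.2)) :=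
    (contDiff_dv hh).comp (by fun_prop)
  exact contDiff_intervalIntegral this

theorem eq_add_smul_divSnd {h : ℝ × ℝ → E} (hh : ContDiff ℝ ∞ h) (x : ℝ × ℝ) :
    h x = h (x.1, 0) + x.2 • divSnd h x := by
  have key : ∫ t in (0 : ℝ)..1, x.2 • dv h (x.1, t * x.2)
      = h (x.1, 1 * x.2) - h (x.1, 0 * x.2) := by
    refine intervalIntegral.integral_eq_sub_of_hasDerivAt
      (f := fun t => h (x.1, t * x.2)) (fun t _ => ?_) ?_
    · have h1 := hasDerivAt_snd_line ((hh.differentiable (by simp)) (x.1, t * x.2))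
      have h2 : HasDerivAt (fun t : ℝ => t * x.2) x.2 t := by
        simpa using (hasDerivAt_id t).mul_const x.2
      exact HasDerivAt.scomp t h1 h2
    · refine Continuous.intervalIntegrable ?_ _ _
      have := (contDiff_dv hh).continuous
      fun_prop
  rw [intervalIntegral.integral_smul, one_mul, zero_mul] at key
  rw [divSnd, key]
  simp

end Division

/-! ### Coefficients with the moments of a point mass at `-1` -/

/-- The coefficients `(-1) ^ k / ∏_{i ≤ k} (2 ^ i - 1)`. -/
def alternatingCoeff (k : ℕ) : ℝ :=
  (-1) ^ k / ∏ i ∈ Finset.range k, ((2 : ℝ) ^ (i + 1) - 1)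

theorem two_pow_succ_sub_one_pos (i : ℕ) : (0 : ℝ) < 2 ^ (i + 1) - 1 := by
  have : (1 : ℝ) < 2 ^ (i + 1) := one_lt_pow₀ one_lt_two (by simp)
  linarith

theorem alternatingCoeff_succ_mul (k : ℕ) :
    alternatingCoeff (k + 1) * ((2 : ℝ) ^ (k + 1) - 1) = -alternatingCoeff k := by
  have h := (two_pow_succ_sub_one_pos k).ne'
  have h' : ∏ i ∈ Finset.range k, ((2 : ℝ) ^ (i + 1) - 1) ≠ 0 :=
    Finset.prod_ne_zero_iff.2 fun i _ => (two_pow_succ_sub_one_pos i).ne'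
  rw [alternatingCoeff, alternatingCoeff, Finset.prod_range_succ]
  field_simp
  ring

theorem summable_alternatingCoeff (n : ℕ) :
    Summable fun k => alternatingCoeff k * ((2 : ℝ) ^ k) ^ n := by
  refine summable_of_ratio_norm_eventually_le (r := 1 / 2) (by norm_num) ?_
  filter_upwards [eventually_ge_atTop (n + 1)] with k hk
  have hpos := two_pow_succ_sub_one_pos k
  have h1 : (2 : ℝ) ^ n * 2 ≤ 2 ^ (k + 1) - 1 := by
    have h2 : (2 : ℝ) ^ (n + 1) ≤ 2 ^ k := pow_le_pow_right₀ one_le_two hk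
    have h3 : (1 : ℝ) ≤ 2 ^ k := one_le_pow₀ one_le_two
    rw [pow_succ] at h2 ⊢
    linarith
  have e : alternatingCoeff (k + 1) = -alternatingCoeff k / (2 ^ (k + 1) - 1) := by
    rw [← alternatingCoeff_succ_mul]; field_simp
  rw [e]
  have e2 : -alternatingCoeff k / (2 ^ (k + 1) - 1) * ((2 : ℝ) ^ (k + 1)) ^ n
      = (2 ^ n / (2 ^ (k + 1) - 1)) * -(alternatingCoeff k * (2 ^ k) ^ n) := by
    rw [pow_succ (2 : ℝ) k, mul_pow]; ring
  rw [e2, norm_mul, norm_neg]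
  refine mul_le_mul_of_nonneg_right ?_ (norm_nonneg _)
  rw [Real.norm_of_nonneg (by positivity), div_le_div_iff₀ hpos two_pos]
  linarith

/-- The entire function `Φ(z) = ∑ aₖ zᵏ` with `aₖ` the alternating coefficients satisfies `Φ(2z) =
(1 - z) Φ(z)`, by the recurrence for `aₖ`. The sums here are its values at `z = 2ⁿ`. Since `Φ(2) = 0
· Φ(1)`, all values with `n ≥ 1` vanish. -/
theorem tsum_alternatingCoeff_succ (n : ℕ) :
    ∑' k, alternatingCoeff k * ((2 : ℝ) ^ k) ^ (n + 1)
      = (1 - 2 ^ n) * ∑' k, alternatingCoeff k * ((2 : ℝ) ^ k) ^ n := by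
  have hs := summable_alternatingCoeff n
  have hs' := summable_alternatingCoeff (n + 1)
  have h1 : ∑' k, alternatingCoeff k * ((2 : ℝ) ^ k) ^ (n + 1)
      - ∑' k, alternatingCoeff k * ((2 : ℝ) ^ k) ^ n
      = ∑' k, alternatingCoeff k * ((2 : ℝ) ^ k - 1) * ((2 : ℝ) ^ k) ^ n := by
    rw [← hs'.tsum_sub hs]
    exact tsum_congr fun k => by ring
  have hs'' : Summable fun k => alternatingCoeff k * ((2 : ℝ) ^ k - 1) * ((2 : ℝ) ^ k) ^ n :=
    (hs'.sub hs).congr fun k => by ring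
  rw [hs''.tsum_eq_zero_add] at h1
  have h2 : ∀ k, alternatingCoeff (k + 1) * ((2 : ℝ) ^ (k + 1) - 1) * ((2 : ℝ) ^ (k + 1)) ^ n
      = -2 ^ n * (alternatingCoeff k * ((2 : ℝ) ^ k) ^ n) := fun k => by
    rw [alternatingCoeff_succ_mul, pow_succ (2 : ℝ) k, mul_pow]; ring
  simp_rw [h2] at h1
  rw [tsum_mul_left] at h1
  simp only [pow_zero, sub_self, mul_zero, zero_mul, zero_add] at h1
  linarith

theorem tsum_alternatingCoeff_pow_succ (n : ℕ) :
    ∑' k, alternatingCoeff k * ((2 : ℝ) ^ k) ^ (n + 1) = 0 := by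
  induction n with
  | zero => rw [tsum_alternatingCoeff_succ]; simp
  | succ n ih => rw [tsum_alternatingCoeff_succ, ih, mul_zero]

theorem tsum_alternatingCoeff_pos : 0 < ∑' k, alternatingCoeff k := by
  have hs : Summable alternatingCoeff := by simpa using summable_alternatingCoeff 0
  have he : Summable fun k => alternatingCoeff (2 * k) := hs.comp_injective (i := fun k : ℕ => 2 * k) (fun a b h => by simpa using h)
  have ho : Summable fun k => alternatingCoeff (2 * k + 1) := hs.comp_injective (i := fun k : ℕ => 2 * k + 1) (fun a b h => by simpa using h)
  rw [← tsum_even_add_odd (f := alternatingCoeff) he ho, ← he.tsum_add ho]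
  have hpos : ∀ j, 0 < alternatingCoeff (2 * j) := fun j => by
    rw [alternatingCoeff, pow_mul]
    have := Finset.prod_pos (s := Finset.range (2 * j))
      (fun i _ => two_pow_succ_sub_one_pos i)
    positivity
  have hval : ∀ j, alternatingCoeff (2 * j) + alternatingCoeff (2 * j + 1)
      = alternatingCoeff (2 * j) * (1 - 1 / (2 ^ (2 * j + 1) - 1)) := fun j => by
    have h := (two_pow_succ_sub_one_pos (2 * j)).ne'
    have e : alternatingCoeff (2 * j + 1) = -alternatingCoeff (2 * j) / (2 ^ (2 * j + 1) - 1) := by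
      rw [← alternatingCoeff_succ_mul]; field_simp
    rw [e]; field_simp; ring
  -- Consecutive terms are summed in pairs. The pair `j = 0` is `1 - 1 = 0`, so strict positivity is
  -- read off at `j = 1`.
  refine (he.add ho).tsum_pos (fun j => ?_) 1 ?_
  · rw [hval]
    refine mul_nonneg (hpos j).le ?_
    have : (1 : ℝ) ≤ 2 ^ (2 * j) := one_le_pow₀ one_le_two
    rw [sub_nonneg, div_le_one (two_pow_succ_sub_one_pos _), pow_succ]
    linarith
  · rw [hval]
    exact mul_pos (hpos 1) (by norm_num)

/-- After normalising by the sum of the coefficients, the moments at the nodes `2ᵏ` are `1, 0, 0,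
…`. Hence only the constant term of `(1 - 2ᵏ)ᵐ` survives. These identities will match all
derivatives of the reflected series across `w = 0`. -/
theorem exists_reflection_coeff :
    ∃ c : ℕ → ℝ, (∀ m : ℕ, Summable fun k => |c k| * ((2 : ℝ) ^ k) ^ m) ∧
      ∀ m : ℕ, ∑' k, c k * (1 - (2 : ℝ) ^ k) ^ m = 1 := by
  set S := ∑' k, alternatingCoeff k with hS
  have hS0 : S ≠ 0 := tsum_alternatingCoeff_pos.ne'
  have habs : ∀ m : ℕ, Summable fun k => |alternatingCoeff k / S| * ((2 : ℝ) ^ k) ^ m :=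
    fun m => (((summable_alternatingCoeff m).norm).mul_left (|S|⁻¹)).congr fun k => by
      rw [norm_mul, Real.norm_of_nonneg (by positivity : (0 : ℝ) ≤ (2 ^ k) ^ m), abs_div,
        Real.norm_eq_abs]
      ring
  have hsum : ∀ m n : ℕ, Summable fun k =>
      alternatingCoeff k / S * (1 - (2 : ℝ) ^ k) ^ m * ((2 : ℝ) ^ k) ^ n := fun m n => by
    refine Summable.of_norm_bounded (habs (m + n)) fun k => ?_
    rw [norm_mul, norm_mul, Real.norm_eq_abs, mul_assoc]
    refine mul_le_mul_of_nonneg_left ?_ (abs_nonneg _)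
    rw [Real.norm_of_nonneg (by positivity : (0 : ℝ) ≤ (2 ^ k) ^ n), norm_pow, pow_add]
    refine mul_le_mul_of_nonneg_right (pow_le_pow_left₀ (norm_nonneg _) ?_ _) (by positivity)
    have : (1 : ℝ) ≤ 2 ^ k := one_le_pow₀ one_le_two
    rw [Real.norm_eq_abs, abs_le]
    constructor <;> linarith
  -- Peeling off one factor `1 - 2ᵏ` shifts the second exponent; the spare factor `(2ᵏ)ⁿ` is what
  -- makes the induction on `m` close.
  have hrec : ∀ m n : ℕ,
      ∑' k, alternatingCoeff k / S * (1 - (2 : ℝ) ^ k) ^ (m + 1) * ((2 : ℝ) ^ k) ^ n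
      = ∑' k, alternatingCoeff k / S * (1 - (2 : ℝ) ^ k) ^ m * ((2 : ℝ) ^ k) ^ n
        - ∑' k, alternatingCoeff k / S * (1 - (2 : ℝ) ^ k) ^ m * ((2 : ℝ) ^ k) ^ (n + 1) :=
    fun m n => by
      rw [← (hsum m n).tsum_sub (hsum m (n + 1))]
      exact tsum_congr fun k => by ring
  have hzero : ∀ m n : ℕ,
      ∑' k, alternatingCoeff k / S * (1 - (2 : ℝ) ^ k) ^ m * ((2 : ℝ) ^ k) ^ (n + 1) = 0 := by
    intro m
    induction m with
    | zero =>
      intro n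
      have : ∀ k, alternatingCoeff k / S * (1 - (2 : ℝ) ^ k) ^ 0 * ((2 : ℝ) ^ k) ^ (n + 1)
          = S⁻¹ * (alternatingCoeff k * ((2 : ℝ) ^ k) ^ (n + 1)) := fun k => by ring
      simp_rw [this]
      rw [tsum_mul_left, tsum_alternatingCoeff_pow_succ, mul_zero]
    | succ m ih => intro n; rw [hrec, ih, ih, sub_zero]
  refine ⟨fun k => alternatingCoeff k / S, habs, fun m => ?_⟩
  have : ∑' k, alternatingCoeff k / S * (1 - (2 : ℝ) ^ k) ^ m * ((2 : ℝ) ^ k) ^ 0 = 1 := by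
    induction m with
    | zero =>
      simp only [pow_zero, mul_one]
      rw [tsum_div_const, ← hS, div_self hS0]
    | succ m ih => rw [hrec, ih, hzero, sub_zero]
  simpa using this

/-! ### Smooth even functions are smooth functions of the square -/

/-- Smooth compactly supported functions of `(u, v)` that are even in `v`. -/
structure IsEvenTest (f : ℝ × ℝ → ℝ) : Prop where
  smooth : ContDiff ℝ ∞ f
  compact : HasCompactSupport f
  even : ∀ x, f (x.1, -x.2) = f x

/-- The operator `∂_v / (2 v)`. -/
def halfDivDeriv (f : ℝ × ℝ → ℝ) (x : ℝ × ℝ) : ℝ := divSnd (dv f) x / 2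

theorem IsEvenTest.test_du {f : ℝ × ℝ → ℝ} (hf : IsEvenTest f) : IsEvenTest (du f) where
  smooth := contDiff_du hf.smooth
  compact := hf.compact.fderiv_apply (𝕜 := ℝ) _
  even x := by
    have h1 := hasDerivAt_fst_line ((hf.smooth.differentiable (by simp)) x)
    have h2 := hasDerivAt_fst_line ((hf.smooth.differentiable (by simp)) (x.1, -x.2))
    refine h2.unique (h1.congr_of_eventuallyEq (Eventually.of_forall fun u => ?_))
    exact hf.even (u, x.2)

theorem IsEvenTest.dv_neg {f : ℝ × ℝ → ℝ} (hf : IsEvenTest f) (x : ℝ × ℝ) :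
    dv f (x.1, -x.2) = -dv f x := by
  have h1 := hasDerivAt_snd_line ((hf.smooth.differentiable (by simp)) x)
  have h2 := hasDerivAt_snd_line ((hf.smooth.differentiable (by simp)) (x.1, -x.2))
  have h3 := HasDerivAt.scomp x.2 h2 (hasDerivAt_neg x.2)
  rw [neg_one_smul] at h3
  have h4 := h3.unique (h1.congr_of_eventuallyEq (Eventually.of_forall fun v => hf.even (x.1, v)))
  linarith

theorem IsEvenTest.dv_axis {f : ℝ × ℝ → ℝ} (hf : IsEvenTest f) (a : ℝ) : dv f (a, 0) = 0 := by
  have := hf.dv_neg (a, 0)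
  simp only [neg_zero] at this
  linarith

theorem IsEvenTest.dv_eq {f : ℝ × ℝ → ℝ} (hf : IsEvenTest f) (x : ℝ × ℝ) :
    dv f x = 2 * x.2 * halfDivDeriv f x := by
  have := eq_add_smul_divSnd (contDiff_dv hf.smooth) x
  rw [hf.dv_axis, smul_eq_mul] at this
  rw [halfDivDeriv, this]; ring

/-- With `w = v²` this operator is `∂_w`, so the class of test functions must be stable under it.
Off the axis everything follows by dividing `f_v` by `2v`; on the axis the support needs the second
derivative. -/
theorem IsEvenTest.test_halfDivDeriv {f : ℝ × ℝ → ℝ} (hf : IsEvenTest f) :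
    IsEvenTest (halfDivDeriv f) where
  smooth := (contDiff_divSnd (contDiff_dv hf.smooth)).div_const 2
  compact := by
    refine HasCompactSupport.intro (K := tsupport f) hf.compact fun x hx => ?_
    have hx1 : x ∉ tsupport (fderiv ℝ f) := fun h => hx (tsupport_fderiv_subset ℝ h)
    have hx2 : x ∉ tsupport (dv f) := fun h =>
      hx1 (closure_mono (Function.support_subset_iff'.2 fun y hy => by
        simp [dv, Function.notMem_support.1 hy]) h)
    by_cases h0 : x.2 = 0
    · obtain ⟨a, b⟩ := x
      obtain rfl : b = 0 := h0
      have : fderiv ℝ (dv f) (a, 0) = 0 := by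
        by_contra h
        exact hx2 (tsupport_fderiv_subset ℝ (subset_tsupport _ h))
      rw [halfDivDeriv, divSnd_axis, dv, this]
      simp
    · have h1 := hf.dv_eq x
      rw [image_eq_zero_of_notMem_tsupport hx2] at h1
      simpa [h0] using h1.symm
  even x := by
    by_cases h0 : x.2 = 0
    · rw [h0, neg_zero, ← h0]
    · have h1 := hf.dv_eq x
      have h2 := hf.dv_eq (x.1, -x.2)
      rw [hf.dv_neg, h1] at h2
      have h3 : x.2 * (halfDivDeriv f (x.1, -x.2) - halfDivDeriv f x) = 0 := by
        simp only at h2; linarith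
      exact sub_eq_zero.1 ((mul_eq_zero.1 h3).resolve_left h0)

theorem IsEvenTest.exists_bound {f : ℝ × ℝ → ℝ} (hf : IsEvenTest f) : ∃ C, ∀ x, ‖f x‖ ≤ C :=
  hf.compact.exists_bound_of_continuous hf.smooth.continuous

theorem IsEvenTest.hasFDerivAt_sqrt {f : ℝ × ℝ → ℝ} (hf : IsEvenTest f) {x : ℝ × ℝ}
    (hx : 0 < x.2) : HasFDerivAt (fun y : ℝ × ℝ => f (y.1, √y.2))
      (du f (x.1, √x.2) • ContinuousLinearMap.fst ℝ ℝ ℝ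
        + halfDivDeriv f (x.1, √x.2) • ContinuousLinearMap.snd ℝ ℝ ℝ) x := by
  have h1 := ((hf.smooth.differentiable (by simp)) (x.1, √x.2)).hasFDerivAt
  have h2 : HasFDerivAt (fun y : ℝ × ℝ => (y.1, √y.2))
      ((ContinuousLinearMap.fst ℝ ℝ ℝ).prod ((1 / (2 * √x.2)) • ContinuousLinearMap.snd ℝ ℝ ℝ)) x :=
    hasFDerivAt_fst.prodMk (hasFDerivAt_snd.sqrt hx.ne')
  refine (h1.comp x h2).congr_fderiv ?_
  have hv := hf.dv_eq (x.1, √x.2)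
  have hs : √x.2 ≠ 0 := (Real.sqrt_pos.2 hx).ne'
  ext
  · simp [du]
  · have e : ((0 : ℝ), (√x.2)⁻¹ * 2⁻¹) = ((√x.2)⁻¹ * 2⁻¹) • ((0 : ℝ), (1 : ℝ)) := by simp
    simp only [ContinuousLinearMap.comp_apply, ContinuousLinearMap.prod_apply,
      add_apply, smul_apply]
    simp
    rw [e, map_smul]
    change _ • dv f _ = _
    rw [hv, smul_eq_mul]
    field_simp

/-- The reflected series extending `f (u, √w)` to `w < 0`. -/
def reflectedSeries (c : ℕ → ℝ) (m : ℕ) (f : ℝ × ℝ → ℝ) (x : ℝ × ℝ) : ℝ :=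
  ∑' k, c k * (1 - (2 : ℝ) ^ k) ^ m * f (x.1, √((1 - 2 ^ k) * x.2))

/-- The extension of `f (u, √w)` to the whole plane. -/
def sqrtExtension (c : ℕ → ℝ) (m : ℕ) (f : ℝ × ℝ → ℝ) (x : ℝ × ℝ) : ℝ :=
  f (x.1, √x.2) + reflectedSeries c m f x - f (x.1, 0)

theorem abs_one_sub_two_pow_le (k : ℕ) : |1 - (2 : ℝ) ^ k| ≤ 2 ^ k := by
  have : (1 : ℝ) ≤ 2 ^ k := one_le_pow₀ one_le_two
  rw [abs_le]; constructor <;> linarith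

theorem norm_reflected_term_le (c : ℕ → ℝ) (m k : ℕ) {C r : ℝ} (hr : ‖r‖ ≤ C) :
    ‖c k * (1 - (2 : ℝ) ^ k) ^ m * r‖ ≤ C * (|c k| * (2 ^ k) ^ m) := by
  rw [norm_mul, norm_mul, norm_pow, Real.norm_eq_abs, Real.norm_eq_abs, mul_comm C]
  exact mul_le_mul (mul_le_mul_of_nonneg_left
    (pow_le_pow_left₀ (abs_nonneg _) (abs_one_sub_two_pow_le k) _) (abs_nonneg _)) hr
    (norm_nonneg _) (by positivity)

theorem IsEvenTest.summable_reflected {c : ℕ → ℝ}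
    (hc : ∀ m : ℕ, Summable fun k => |c k| * ((2 : ℝ) ^ k) ^ m) {f : ℝ × ℝ → ℝ}
    (hf : IsEvenTest f) (m : ℕ) (x : ℝ × ℝ) :
    Summable fun k => c k * (1 - (2 : ℝ) ^ k) ^ m * f (x.1, √((1 - 2 ^ k) * x.2)) := by
  obtain ⟨C, hC⟩ := hf.exists_bound
  exact Summable.of_norm_bounded ((hc m).mul_left C)
    fun k => norm_reflected_term_le c m k (hC _)

theorem IsEvenTest.continuous_sqrtExtension {c : ℕ → ℝ}
    (hc : ∀ m : ℕ, Summable fun k => |c k| * ((2 : ℝ) ^ k) ^ m) {f : ℝ × ℝ → ℝ}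
    (hf : IsEvenTest f) (m : ℕ) : Continuous (sqrtExtension c m f) := by
  obtain ⟨C, hC⟩ := hf.exists_bound
  have hf' := hf.smooth.continuous
  refine Continuous.sub (Continuous.add (by fun_prop) ?_) (by fun_prop)
  exact continuous_tsum (fun k => by fun_prop) ((hc m).mul_left C)
    fun k x => norm_reflected_term_le c m k (hC _)

/-- The convention `√t = 0` for `t ≤ 0` lets one formula serve both half-planes. For `w ≥ 0` every
argument `(1 - 2ᵏ) w` is nonpositive, so the series collapses to `f(u, 0)` by the moment identity
and cancels. For `w ≤ 0` the first term cancels instead. -/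
theorem sqrtExtension_of_nonneg {c : ℕ → ℝ}
    (hc1 : ∀ m : ℕ, ∑' k, c k * (1 - (2 : ℝ) ^ k) ^ m = 1) (f : ℝ × ℝ → ℝ) (m : ℕ) {x : ℝ × ℝ}
    (hx : 0 ≤ x.2) : sqrtExtension c m f x = f (x.1, √x.2) := by
  have h : ∀ k : ℕ, √((1 - (2 : ℝ) ^ k) * x.2) = 0 := fun k => by
    have : (1 : ℝ) ≤ 2 ^ k := one_le_pow₀ one_le_two
    exact Real.sqrt_eq_zero_of_nonpos (mul_nonpos_of_nonpos_of_nonneg (by linarith) hx)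
  simp only [sqrtExtension, reflectedSeries, h]
  rw [tsum_mul_right, hc1]
  ring

theorem sqrtExtension_of_nonpos {c : ℕ → ℝ} (f : ℝ × ℝ → ℝ) (m : ℕ) {x : ℝ × ℝ}
    (hx : x.2 ≤ 0) : sqrtExtension c m f x = reflectedSeries c m f x := by
  rw [sqrtExtension, Real.sqrt_eq_zero_of_nonpos hx]
  ring

theorem IsEvenTest.hasFDerivAt_reflected_term {f : ℝ × ℝ → ℝ} (hf : IsEvenTest f) (k : ℕ)
    {x : ℝ × ℝ} (hx : x.2 < 0) :
    HasFDerivAt (fun y : ℝ × ℝ => f (y.1, √((1 - 2 ^ k) * y.2)))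
      (du f (x.1, √((1 - 2 ^ k) * x.2)) • ContinuousLinearMap.fst ℝ ℝ ℝ
        + ((1 - 2 ^ k) * halfDivDeriv f (x.1, √((1 - 2 ^ k) * x.2))) •
          ContinuousLinearMap.snd ℝ ℝ ℝ) x := by
  cases k with
  | zero =>
    have h1 := ((hf.smooth.differentiable (by simp)) (x.1, 0)).hasFDerivAt
    have h2 : HasFDerivAt (fun y : ℝ × ℝ => (y.1, (0 : ℝ)))
      ((ContinuousLinearMap.fst ℝ ℝ ℝ).prod 0) x := hasFDerivAt_fst.prodMk (hasFDerivAt_const _ _)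
    simp only [pow_zero, sub_self, zero_mul, Real.sqrt_zero, zero_smul, add_zero]
    refine (h1.comp x h2).congr_fderiv ?_
    ext
    · simp [du]
    · simp
      exact map_zero (fderiv ℝ f (x.1, 0))
  | succ k =>
    have hk := two_pow_succ_sub_one_pos k
    have h1 := hf.hasFDerivAt_sqrt (x := (x.1, (1 - 2 ^ (k + 1)) * x.2))
      (mul_pos_of_neg_of_neg (by linarith) hx)
    have h2 : HasFDerivAt (fun y : ℝ × ℝ => (y.1, (1 - (2 : ℝ) ^ (k + 1)) * y.2))
      ((ContinuousLinearMap.fst ℝ ℝ ℝ).prod ((1 - (2 : ℝ) ^ (k + 1)) •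
        ContinuousLinearMap.snd ℝ ℝ ℝ)) x := hasFDerivAt_fst.prodMk (hasFDerivAt_snd.const_mul _)
    refine (h1.comp x h2).congr_fderiv ?_
    ext
    · simp
    · simp; ring

/-- Termwise differentiation on the open half-plane. Each `∂_w` produces a factor `1 - 2ᵏ`, recorded
by raising `m`; compact support bounds the functions and the weighted summability of `c` dominates
the series. -/
theorem IsEvenTest.hasFDerivAt_reflectedSeries {c : ℕ → ℝ}
    (hc : ∀ m : ℕ, Summable fun k => |c k| * ((2 : ℝ) ^ k) ^ m) {f : ℝ × ℝ → ℝ}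
    (hf : IsEvenTest f) (m : ℕ) {x : ℝ × ℝ} (hx : x.2 < 0) :
    HasFDerivAt (reflectedSeries c m f)
      (reflectedSeries c m (du f) x • ContinuousLinearMap.fst ℝ ℝ ℝ
        + reflectedSeries c (m + 1) (halfDivDeriv f) x • ContinuousLinearMap.snd ℝ ℝ ℝ) x := by
  obtain ⟨C, hC⟩ := hf.test_du.exists_bound
  obtain ⟨D, hD⟩ := hf.test_halfDivDeriv.exists_bound
  set p : ℕ → ℝ × ℝ → ℝ × ℝ := fun k y => (y.1, √((1 - 2 ^ k) * y.2)) with hp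
  have key := hasFDerivAt_tsum_of_isPreconnected (𝕜 := ℝ)
    (u := fun k => C * (|c k| * (2 ^ k) ^ m) * ‖ContinuousLinearMap.fst ℝ ℝ ℝ‖
      + D * (|c k| * (2 ^ k) ^ (m + 1)) * ‖ContinuousLinearMap.snd ℝ ℝ ℝ‖)
    (f := fun k y => c k * (1 - (2 : ℝ) ^ k) ^ m * f (p k y))
    (f' := fun k y => (c k * (1 - (2 : ℝ) ^ k) ^ m * du f (p k y)) •
        ContinuousLinearMap.fst ℝ ℝ ℝ
      + (c k * (1 - (2 : ℝ) ^ k) ^ (m + 1) * halfDivDeriv f (p k y)) •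
        ContinuousLinearMap.snd ℝ ℝ ℝ)
    (s := {y : ℝ × ℝ | y.2 < 0}) (x₀ := x) (x := x)
    ((((hc m).mul_left C).mul_right _).add (((hc (m + 1)).mul_left D).mul_right _))
    (isOpen_lt continuous_snd continuous_const)
    (convex_halfSpace_lt (IsLinearMap.mk (fun _ _ => rfl) fun _ _ => rfl) 0).isPreconnected
    (fun k y hy => ?_) (fun k y _ => ?_) hx (hf.summable_reflected hc m x) hx
  · refine key.congr_fderiv ?_
    have s1 := hf.test_du.summable_reflected hc m x
    have s2 := hf.test_halfDivDeriv.summable_reflected hc (m + 1) x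
    rw [(s1.smul_const _).tsum_add (s2.smul_const _), s1.tsum_smul_const, s2.tsum_smul_const]
    rfl
  · refine ((hf.hasFDerivAt_reflected_term k hy).const_mul _).congr_fderiv ?_
    rw [smul_add, smul_smul, smul_smul, pow_succ, mul_assoc (c k), mul_assoc (c k),
      mul_assoc (c k), mul_assoc ((1 - (2 : ℝ) ^ k) ^ m)]
  · refine (norm_add_le _ _).trans ?_
    rw [norm_smul, norm_smul]
    gcongr
    · exact norm_reflected_term_le c m k (hC _)
    · exact norm_reflected_term_le c (m + 1) k (hD _)

/-- The candidate derivative is built from extensions of the same type, hence continuous on the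
whole plane. It is the true derivative on both open half-planes, and a continuous function whose
derivative has a limit at the boundary is differentiable up to it; the two one-sided statements are
then glued. -/
theorem IsEvenTest.hasFDerivAt_sqrtExtension {c : ℕ → ℝ}
    (hc : ∀ m : ℕ, Summable fun k => |c k| * ((2 : ℝ) ^ k) ^ m)
    (hc1 : ∀ m : ℕ, ∑' k, c k * (1 - (2 : ℝ) ^ k) ^ m = 1) {f : ℝ × ℝ → ℝ}
    (hf : IsEvenTest f) (m : ℕ) (x : ℝ × ℝ) :
    HasFDerivAt (sqrtExtension c m f)
      (sqrtExtension c m (du f) x • ContinuousLinearMap.fst ℝ ℝ ℝ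
        + sqrtExtension c (m + 1) (halfDivDeriv f) x • ContinuousLinearMap.snd ℝ ℝ ℝ) x := by
  set L : ℝ × ℝ → (ℝ × ℝ →L[ℝ] ℝ) := fun x =>
    sqrtExtension c m (du f) x • ContinuousLinearMap.fst ℝ ℝ ℝ
      + sqrtExtension c (m + 1) (halfDivDeriv f) x • ContinuousLinearMap.snd ℝ ℝ ℝ with hL
  have hLc : Continuous L :=
    ((hf.test_du.continuous_sqrtExtension hc m).smul continuous_const).add
      ((hf.test_halfDivDeriv.continuous_sqrtExtension hc (m + 1)).smul continuous_const)
  have hcont := hf.continuous_sqrtExtension hc m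
  have hlin : IsLinearMap ℝ (fun y : ℝ × ℝ => y.2) := IsLinearMap.mk (fun _ _ => rfl) fun _ _ => rfl
  have hpos : ∀ y : ℝ × ℝ, 0 < y.2 → HasFDerivAt (sqrtExtension c m f) (L y) y := fun y hy => by
    simp only [hL]
    rw [sqrtExtension_of_nonneg hc1 _ _ hy.le, sqrtExtension_of_nonneg hc1 _ _ hy.le]
    refine (hf.hasFDerivAt_sqrt hy).congr_of_eventuallyEq ?_
    filter_upwards [(isOpen_lt continuous_const continuous_snd).mem_nhds hy] with z hz
    exact sqrtExtension_of_nonneg hc1 _ _ (le_of_lt hz)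
  have hneg : ∀ y : ℝ × ℝ, y.2 < 0 → HasFDerivAt (sqrtExtension c m f) (L y) y := fun y hy => by
    simp only [hL]
    rw [sqrtExtension_of_nonpos _ _ hy.le, sqrtExtension_of_nonpos _ _ hy.le]
    refine (hf.hasFDerivAt_reflectedSeries hc m hy).congr_of_eventuallyEq ?_
    filter_upwards [(isOpen_lt continuous_snd continuous_const).mem_nhds hy] with z hz
    exact sqrtExtension_of_nonpos _ _ (le_of_lt hz)
  change HasFDerivAt _ (L x) x
  have glue : ∀ s : Set (ℝ × ℝ), Convex ℝ s → IsOpen s →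
      (∀ y ∈ s, HasFDerivAt (sqrtExtension c m f) (L y) y) →
      HasFDerivWithinAt (sqrtExtension c m f) (L x) (closure s) x := fun s hs hso h => by
    refine hasFDerivWithinAt_closure_of_tendsto_fderiv
      (fun y hy => (h y hy).differentiableAt.differentiableWithinAt) hs hso
      (fun y _ => hcont.continuousWithinAt) ?_
    refine (hLc.continuousWithinAt (s := s) (x := x)).tendsto.congr' ?_
    filter_upwards [self_mem_nhdsWithin] with y hy using (h y hy).fderiv.symm
  have h1 := glue {y | 0 < y.2} (convex_halfSpace_gt hlin 0)
    (isOpen_lt continuous_const continuous_snd) hpos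
  have h2 := glue {y | y.2 < 0} (convex_halfSpace_lt hlin 0)
    (isOpen_lt continuous_snd continuous_const) hneg
  have e1 : {y : ℝ × ℝ | 0 < y.2} = univ ×ˢ Ioi 0 := by ext; simp
  have e2 : {y : ℝ × ℝ | y.2 < 0} = univ ×ˢ Iio 0 := by ext; simp
  rw [e1, closure_prod_eq, closure_Ioi, closure_univ] at h1
  rw [e2, closure_prod_eq, closure_Iio, closure_univ] at h2
  have h3 := h1.union h2
  rw [← prod_union, union_comm, Iic_union_Ici, univ_prod_univ] at h3
  exact h3.hasFDerivAt univ_mem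

/-- The partial derivatives of an extension are again extensions, of `du f` with the same `m` and of
`halfDivDeriv f` with `m + 1`. All of them are continuous, so induction on the order gives
smoothness. -/
theorem IsEvenTest.contDiff_sqrtExtension {c : ℕ → ℝ}
    (hc : ∀ m : ℕ, Summable fun k => |c k| * ((2 : ℝ) ^ k) ^ m)
    (hc1 : ∀ m : ℕ, ∑' k, c k * (1 - (2 : ℝ) ^ k) ^ m = 1) {f : ℝ × ℝ → ℝ}
    (hf : IsEvenTest f) (m : ℕ) : ContDiff ℝ ∞ (sqrtExtension c m f) := by
  rw [contDiff_infty]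
  intro n
  induction n generalizing m f with
  | zero => simpa using hf.continuous_sqrtExtension hc m
  | succ n ih =>
    rw [Nat.cast_succ, contDiff_succ_iff_hasFDerivAt]
    exact ⟨_, ((ih hf.test_du m).smul contDiff_const).add
      ((ih hf.test_halfDivDeriv (m + 1)).smul contDiff_const),
      hf.hasFDerivAt_sqrtExtension hc hc1 m⟩

theorem IsEvenTest.exists_comp_sq {f : ℝ × ℝ → ℝ} (hf : IsEvenTest f) :
    ∃ g : ℝ × ℝ → ℝ, ContDiff ℝ ∞ g ∧ ∀ x, f x = g (x.1, x.2 ^ 2) := by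
  obtain ⟨c, hc, hc1⟩ := exists_reflection_coeff
  refine ⟨_, hf.contDiff_sqrtExtension hc hc1 0, fun x => ?_⟩
  rw [sqrtExtension_of_nonneg hc1 _ _ (sq_nonneg _), Real.sqrt_sq_eq_abs]
  rcases abs_choice x.2 with h | h
  · simp [h]
  · simp only [h]; exact (hf.even x).symm

/-! ### Germs of smooth maps -/

section SmoothNear

variable {E F G : Type*} [NormedAddCommGroup E] [NormedSpace ℝ E]
  [NormedAddCommGroup F] [NormedSpace ℝ F] [NormedAddCommGroup G] [NormedSpace ℝ G]

/-- `f` is smooth on a neighbourhood of `p`. -/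
def SmoothNear (f : E → F) (p : E) : Prop := ∀ᶠ x in 𝓝 p, ContDiffAt ℝ ∞ f x

theorem SmoothNear.contDiffAt {f : E → F} {p : E} (h : SmoothNear f p) : ContDiffAt ℝ ∞ f p :=
  h.self_of_nhds

theorem SmoothNear.differentiableAt {f : E → F} {p : E} (h : SmoothNear f p) :
    DifferentiableAt ℝ f p := h.contDiffAt.differentiableAt (by simp)

theorem SmoothNear.continuousAt {f : E → F} {p : E} (h : SmoothNear f p) :
    ContinuousAt f p := h.contDiffAt.continuousAt

theorem SmoothNear.eventually {f : E → F} {p : E} (h : SmoothNear f p) :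
    ∀ᶠ x in 𝓝 p, SmoothNear f x := eventually_eventually_nhds.2 h

theorem SmoothNear.eventually_differentiableAt {f : E → F} {p : E} (h : SmoothNear f p) :
    ∀ᶠ x in 𝓝 p, DifferentiableAt ℝ f x :=
  h.eventually.mono fun _ hx => hx.differentiableAt

theorem smoothNear_of_contDiff {f : E → F} (h : ContDiff ℝ ∞ f) (p : E) : SmoothNear f p :=
  Eventually.of_forall fun _ => h.contDiffAt

theorem smoothNear_of_contDiffOn {f : E → F} {s : Set E} {p : E} (h : ContDiffOn ℝ ∞ f s)
    (hs : IsOpen s) (hp : p ∈ s) : SmoothNear f p := by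
  filter_upwards [hs.mem_nhds hp] with x hx using h.contDiffAt (hs.mem_nhds hx)

theorem SmoothNear.congr {f g : E → F} {p : E} (h : SmoothNear f p) (hfg : g =ᶠ[𝓝 p] f) :
    SmoothNear g p := by
  filter_upwards [h, hfg.eventuallyEq_nhds] with x hx hx' using hx.congr_of_eventuallyEq hx'

theorem SmoothNear.comp {g : F → G} {f : E → F} {p : E} (hg : SmoothNear g (f p))
    (hf : SmoothNear f p) : SmoothNear (fun x => g (f x)) p := by
  filter_upwards [hf, hf.continuousAt.eventually hg] with x hx hx' using hx'.comp x hx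

theorem smoothNear_const (c : F) (p : E) : SmoothNear (fun _ : E => c) p :=
  smoothNear_of_contDiff contDiff_const p

theorem SmoothNear.add {f g : E → F} {p : E} (hf : SmoothNear f p) (hg : SmoothNear g p) :
    SmoothNear (fun x => f x + g x) p := by
  filter_upwards [hf, hg] with x hx hx' using hx.add hx'

theorem SmoothNear.sub {f g : E → F} {p : E} (hf : SmoothNear f p) (hg : SmoothNear g p) :
    SmoothNear (fun x => f x - g x) p := by
  filter_upwards [hf, hg] with x hx hx' using hx.sub hx'

theorem SmoothNear.neg {f : E → F} {p : E} (hf : SmoothNear f p) :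
    SmoothNear (fun x => -f x) p := by
  filter_upwards [hf] with x hx using hx.neg

theorem SmoothNear.smul {f : E → ℝ} {g : E → F} {p : E} (hf : SmoothNear f p)
    (hg : SmoothNear g p) : SmoothNear (fun x => f x • g x) p := by
  filter_upwards [hf, hg] with x hx hx' using hx.smul hx'

theorem SmoothNear.mul {f g : E → ℝ} {p : E} (hf : SmoothNear f p) (hg : SmoothNear g p) :
    SmoothNear (fun x => f x * g x) p := by
  filter_upwards [hf, hg] with x hx hx' using hx.mul hx'

theorem SmoothNear.pow {f : E → ℝ} {p : E} (hf : SmoothNear f p) (n : ℕ) :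
    SmoothNear (fun x => f x ^ n) p := by
  filter_upwards [hf] with x hx using hx.pow n

theorem SmoothNear.div {f g : E → ℝ} {p : E} (hf : SmoothNear f p) (hg : SmoothNear g p)
    (h0 : g p ≠ 0) : SmoothNear (fun x => f x / g x) p := by
  filter_upwards [hf, hg, hg.continuousAt.eventually_ne h0] with x hx hx' h using hx.div hx' h

theorem SmoothNear.sqrt {f : E → ℝ} {p : E} (hf : SmoothNear f p) (h0 : f p ≠ 0) :
    SmoothNear (fun x => √(f x)) p := by
  filter_upwards [hf, hf.continuousAt.eventually_ne h0] with x hx h using hx.sqrt h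

theorem SmoothNear.prodMk {f : E → F} {g : E → G} {p : E} (hf : SmoothNear f p)
    (hg : SmoothNear g p) : SmoothNear (fun x => (f x, g x)) p := by
  filter_upwards [hf, hg] with x hx hx' using hx.prodMk hx'

theorem SmoothNear.smoothNear_fderiv {f : E → F} {p : E} (hf : SmoothNear f p) :
    SmoothNear (fderiv ℝ f) p := by
  filter_upwards [hf] with x hx using hx.fderiv_right (m := ∞) le_rfl

theorem SmoothNear.fderiv_apply {f : E → F} {p : E} (hf : SmoothNear f p) (w : E) :
    SmoothNear (fun x => fderiv ℝ f x w) p := by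
  filter_upwards [hf.smoothNear_fderiv] with x hx using hx.clm_apply contDiffAt_const

theorem SmoothNear.smoothNear_du {f : ℝ × ℝ → F} {p : ℝ × ℝ} (hf : SmoothNear f p) : SmoothNear (du f) p :=
  hf.fderiv_apply _

theorem SmoothNear.smoothNear_dv {f : ℝ × ℝ → F} {p : ℝ × ℝ} (hf : SmoothNear f p) : SmoothNear (dv f) p :=
  hf.fderiv_apply _

theorem SmoothNear.fst {f : E → F × G} {p : E} (hf : SmoothNear f p) :
    SmoothNear (fun x => (f x).1) p := by
  filter_upwards [hf] with x hx using hx.fst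

theorem SmoothNear.snd {f : E → F × G} {p : E} (hf : SmoothNear f p) :
    SmoothNear (fun x => (f x).2) p := by
  filter_upwards [hf] with x hx using hx.snd

theorem smoothNear_id (p : E) : SmoothNear (fun x : E => x) p := smoothNear_of_contDiff contDiff_id p

theorem smoothNear_clm (L : E →L[ℝ] F) (p : E) : SmoothNear (fun x => L x) p :=
  smoothNear_of_contDiff L.contDiff p

theorem SmoothNear.inner {f g : E → E3} {p : E} (hf : SmoothNear f p) (hg : SmoothNear g p) :
    SmoothNear (fun x => inner ℝ (f x) (g x)) p := by
  filter_upwards [hf, hg] with x hx hx' using hx.inner ℝ hx'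

theorem smoothNear_vec3 {f g h : E → ℝ} {p : E} (hf : SmoothNear f p) (hg : SmoothNear g p)
    (hh : SmoothNear h p) : SmoothNear (fun x => (!₂[f x, g x, h x] : E3)) p := by
  filter_upwards [hf, hg, hh] with x hx hx' hx''
  rw [contDiffAt_euclidean]
  intro i
  fin_cases i <;> simpa

theorem SmoothNear.coord {f : E → E3} {p : E} (hf : SmoothNear f p) (i : Fin 3) :
    SmoothNear (fun x => f x i) p := by
  filter_upwards [hf] with x hx using contDiffAt_euclidean.1 hx i

end SmoothNear

/-! ### Local forms of the division and square theorems -/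

section Local

variable {E : Type} [NormedAddCommGroup E] [NormedSpace ℝ E]

theorem SmoothNear.exists_contDiff {f : ℝ × ℝ → E} {p : ℝ × ℝ} (hf : SmoothNear f p) :
    ∃ g : ℝ × ℝ → E, ContDiff ℝ ∞ g ∧ HasCompactSupport g ∧ g =ᶠ[𝓝 p] f := by
  obtain ⟨ε, hε, hball⟩ := Metric.eventually_nhds_iff_ball.1 hf
  let b : ContDiffBump p := ⟨ε / 4, ε / 2, by positivity, by linarith⟩
  refine ⟨fun x => b x • f x, ?_, b.hasCompactSupport.smul_right, ?_⟩
  · rw [contDiff_iff_contDiffAt]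
    intro x
    by_cases hx : x ∈ Metric.ball p ε
    · exact b.contDiff.contDiffAt.smul (hball x hx)
    · have h0 : x ∉ tsupport b := by
        rw [b.tsupport_eq]
        simp only [Metric.mem_ball, not_lt] at hx
        simp only [Metric.mem_closedBall, not_le]
        change ε / 2 < _
        linarith
      refine (contDiffAt_const (c := (0 : E))).congr_of_eventuallyEq ?_
      filter_upwards [(isClosed_tsupport b).isOpen_compl.mem_nhds h0] with y hy
      rw [image_eq_zero_of_notMem_tsupport hy, zero_smul]
  · filter_upwards [b.eventuallyEq_one] with x hx
    rw [hx]; simp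

theorem continuous_axis : Continuous fun x : ℝ × ℝ => ((x.1, 0) : ℝ × ℝ) := by fun_prop

theorem eventually_axis {P : ℝ × ℝ → Prop} (h : ∀ᶠ x in 𝓝 (0 : ℝ × ℝ), P x) :
    ∀ᶠ x in 𝓝 (0 : ℝ × ℝ), P (x.1, 0) :=
  (continuous_axis.tendsto' 0 0 rfl).eventually h

theorem continuous_reflect : Continuous fun x : ℝ × ℝ => ((x.1, -x.2) : ℝ × ℝ) := by fun_prop

theorem eventually_reflect {P : ℝ × ℝ → Prop} (h : ∀ᶠ x in 𝓝 (0 : ℝ × ℝ), P x) :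
    ∀ᶠ x in 𝓝 (0 : ℝ × ℝ), P (x.1, -x.2) :=
  (continuous_reflect.tendsto' 0 0 (by simp)).eventually h

theorem SmoothNear.exists_eq_add_smul [CompleteSpace E] {f : ℝ × ℝ → E}
    (hf : SmoothNear f 0) : ∃ k : ℝ × ℝ → E, ContDiff ℝ ∞ k ∧
      (∀ᶠ x in 𝓝 (0 : ℝ × ℝ), f x = f (x.1, 0) + x.2 • k x) ∧
      ∀ᶠ x in 𝓝 (0 : ℝ × ℝ), k (x.1, 0) = dv f (x.1, 0) := by
  obtain ⟨g, hg, -, hgf⟩ := hf.exists_contDiff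
  refine ⟨divSnd g, contDiff_divSnd hg, ?_, ?_⟩
  · filter_upwards [hgf, eventually_axis hgf] with x h1 h2
    rw [← h1, ← h2]; exact eq_add_smul_divSnd hg x
  · filter_upwards [eventually_axis hgf.eventuallyEq_nhds] with x hx
    rw [divSnd_axis, dv, dv, hx.fderiv_eq]

theorem SmoothNear.exists_comp_sq {f : ℝ × ℝ → ℝ} (hf : SmoothNear f 0)
    (he : ∀ᶠ x in 𝓝 (0 : ℝ × ℝ), f (x.1, -x.2) = f x) :
    ∃ g : ℝ × ℝ → ℝ, ContDiff ℝ ∞ g ∧ ∀ᶠ x in 𝓝 (0 : ℝ × ℝ), f x = g (x.1, x.2 ^ 2) := by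
  obtain ⟨h, hh, hc, hhf⟩ := hf.exists_contDiff
  have hr : ContDiff ℝ ∞ fun x : ℝ × ℝ => ((x.1, -x.2) : ℝ × ℝ) := by fun_prop
  -- The cut-off representative `h` need not be even away from the origin; symmetrising leaves the
  -- germ unchanged.
  have htest : IsEvenTest fun x => (h x + h (x.1, -x.2)) / 2 :=
    { smooth := (hh.add (hh.comp hr)).div_const 2
      compact := by
        have h2 : HasCompactSupport fun x : ℝ × ℝ => h (x.1, -x.2) :=
          hc.comp_homeomorph ((Homeomorph.refl ℝ).prodCongr (Homeomorph.neg ℝ))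
        exact (hc.add h2).mul_right (f' := fun _ => (2 : ℝ)⁻¹)
      even := fun x => by simp only [neg_neg, Prod.mk.eta]; ring }
  obtain ⟨g, hg, hgx⟩ := htest.exists_comp_sq
  refine ⟨g, hg, ?_⟩
  filter_upwards [hhf, eventually_reflect hhf, he] with x h1 h2 h3
  rw [← hgx, h1, h2, h3]; ring

end Local

/-! ### Germs of diffeomorphisms -/

section Diffeo

variable {E F G : Type*} [NormedAddCommGroup E] [NormedSpace ℝ E]
  [NormedAddCommGroup F] [NormedSpace ℝ F] [NormedAddCommGroup G] [NormedSpace ℝ G]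

theorem SmoothNear.exists_diffeo [CompleteSpace E] {f : E → F} {a : E} (hf : SmoothNear f a)
    (e : E ≃L[ℝ] F) (he : fderiv ℝ f a = e) :
    ∃ Φ : OpenPartialHomeomorph E F, IsSmoothDiffeo Φ ∧ a ∈ Φ.source ∧ ∀ x, Φ x = f x := by
  have hfd : HasFDerivAt f (e : E →L[ℝ] F) a := he ▸ hf.differentiableAt.hasFDerivAt
  -- Invertibility of the derivative is an open condition. Restricting to the points where it holds
  -- makes the inverse smooth on the whole target and not only at the image of `a`.
  have hinv : ∀ᶠ x in 𝓝 a, fderiv ℝ f x ∈ range ((↑) : (E ≃L[ℝ] F) → E →L[ℝ] F) :=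
    hf.smoothNear_fderiv.continuousAt.eventually (he ▸ ContinuousLinearEquiv.nhds e)
  obtain ⟨s, hs, hso, has⟩ := eventually_nhds_iff.1 (hf.and hinv)
  let R := hf.contDiffAt.toOpenPartialHomeomorph f hfd (by simp)
  have hR : a ∈ R.source := hf.contDiffAt.mem_toOpenPartialHomeomorph_source hfd (by simp)
  refine ⟨R.restrOpen s hso, ⟨?_, ?_⟩, ⟨hR, has⟩, fun x => rfl⟩
  · intro x hx
    exact (hs x hx.2).1.contDiffWithinAt
  · intro y hy
    have hx := (R.restrOpen s hso).map_target hy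
    obtain ⟨e', he'⟩ := (hs _ hx.2).2
    refine ContDiffAt.contDiffWithinAt ?_
    refine (R.restrOpen s hso).contDiffAt_symm (f₀' := e') hy ?_ (hs _ hx.2).1
    rw [he']
    exact ((hs _ hx.2).1.differentiableAt (by simp)).hasFDerivAt

theorem SmoothNear.exists_diffeo_of_injective [FiniteDimensional ℝ E] {f : E → E} {a : E}
    (hf : SmoothNear f a) (h : ∀ w, fderiv ℝ f a w = 0 → w = 0) :
    ∃ Φ : OpenPartialHomeomorph E E, IsSmoothDiffeo Φ ∧ a ∈ Φ.source ∧ ∀ x, Φ x = f x := by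
  have := FiniteDimensional.complete ℝ E
  have hinj : Function.Injective (fderiv ℝ f a : E →ₗ[ℝ] E) :=
    (injective_iff_map_eq_zero _).2 h
  exact hf.exists_diffeo (LinearEquiv.ofInjectiveEndo _ hinj).toContinuousLinearEquiv (by ext; rfl)

theorem IsSmoothDiffeo.smoothNear {Φ : OpenPartialHomeomorph E F} (h : IsSmoothDiffeo Φ) {x : E}
    (hx : x ∈ Φ.source) : SmoothNear Φ x := smoothNear_of_contDiffOn h.1 Φ.open_source hx

theorem IsSmoothDiffeo.smoothNear_symm {Φ : OpenPartialHomeomorph E F} (h : IsSmoothDiffeo Φ)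
    {x : F} (hx : x ∈ Φ.target) : SmoothNear Φ.symm x := smoothNear_of_contDiffOn h.2 Φ.open_target hx

theorem IsSmoothDiffeo.symm {Φ : OpenPartialHomeomorph E F} (h : IsSmoothDiffeo Φ) :
    IsSmoothDiffeo Φ.symm := ⟨h.2, by simpa using h.1⟩

theorem isSmoothDiffeo_refl : IsSmoothDiffeo (OpenPartialHomeomorph.refl E) :=
  ⟨contDiff_id.contDiffOn, contDiff_id.contDiffOn⟩

theorem IsSmoothDiffeo.trans {Φ : OpenPartialHomeomorph E F} {Ψ : OpenPartialHomeomorph F G}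
    (h : IsSmoothDiffeo Φ) (h' : IsSmoothDiffeo Ψ) : IsSmoothDiffeo (Φ.trans Ψ) := by
  refine ⟨?_, ?_⟩
  · exact h'.1.comp (h.1.mono fun x hx => hx.1) fun x hx => hx.2
  · exact h.2.comp (h'.2.mono fun x hx => hx.1) fun x hx => hx.2

theorem IsSmoothDiffeo.restrOpen {Φ : OpenPartialHomeomorph E F} (h : IsSmoothDiffeo Φ)
    (s : Set E) (hs : IsOpen s) : IsSmoothDiffeo (Φ.restrOpen s hs) :=
  ⟨h.1.mono fun _ hx => hx.1, h.2.mono fun _ hx => hx.1⟩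

theorem fderiv_eq_zero_imp_of_leftInverse {f : E → F} {g : F → E} {a : E}
    (hf : DifferentiableAt ℝ f a) (hg : DifferentiableAt ℝ g (f a))
    (h : ∀ᶠ x in 𝓝 a, g (f x) = x) {w : E} (hw : fderiv ℝ f a w = 0) : w = 0 := by
  have h1 : HasFDerivAt (fun x => g (f x)) _ a := hg.hasFDerivAt.comp a hf.hasFDerivAt
  have h2 : HasFDerivAt (fun x => g (f x)) (ContinuousLinearMap.id ℝ E) a :=
    (hasFDerivAt_id a).congr_of_eventuallyEq h
  have h3 := DFunLike.congr_fun (h1.unique h2) w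
  simpa [hw] using h3.symm

theorem IsSmoothDiffeo.fderiv_eq_zero_imp {Φ : OpenPartialHomeomorph E F} (h : IsSmoothDiffeo Φ)
    {x : E} (hx : x ∈ Φ.source) {w : E} (hw : fderiv ℝ Φ x w = 0) : w = 0 :=
  fderiv_eq_zero_imp_of_leftInverse (h.smoothNear hx).differentiableAt
    (h.smoothNear_symm (Φ.map_source hx)).differentiableAt (Φ.eventually_left_inverse hx) hw

theorem IsSmoothDiffeo.fderiv_symm_eq_zero_imp {Φ : OpenPartialHomeomorph E F}
    (h : IsSmoothDiffeo Φ) {x : F} (hx : x ∈ Φ.target) {w : F} (hw : fderiv ℝ Φ.symm x w = 0) :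
    w = 0 := h.symm.fderiv_eq_zero_imp (Φ := Φ.symm) hx hw

theorem IsSmoothDiffeo.exists_fderiv_eq {Φ : OpenPartialHomeomorph E F} (h : IsSmoothDiffeo Φ)
    {x : E} (hx : x ∈ Φ.source) (w : F) : ∃ w', fderiv ℝ Φ x w' = w := by
  refine ⟨fderiv ℝ Φ.symm (Φ x) w, ?_⟩
  have hy := Φ.map_source hx
  have h1 : HasFDerivAt (fun y => Φ (Φ.symm y)) _ (Φ x) :=
    HasFDerivAt.comp (g := Φ) (f := Φ.symm) (Φ x)
      (h.smoothNear (Φ.map_target hy)).differentiableAt.hasFDerivAt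
      (h.smoothNear_symm hy).differentiableAt.hasFDerivAt
  have h2 : HasFDerivAt (fun y => Φ (Φ.symm y)) (ContinuousLinearMap.id ℝ F) (Φ x) :=
    (hasFDerivAt_id _).congr_of_eventuallyEq (Φ.eventually_right_inverse hy)
  have h3 := DFunLike.congr_fun (h1.unique h2) w
  simpa [Φ.left_inv hx] using h3

/-- The inverse function theorem for germs. -/
theorem SmoothNear.exists_inverse [FiniteDimensional ℝ E] {f : E → E} {a b : E}
    (hf : SmoothNear f a) (h : ∀ w, fderiv ℝ f a w = 0 → w = 0) (hab : f a = b) :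
    ∃ g : E → E, SmoothNear g b ∧ g b = a ∧ (∀ᶠ y in 𝓝 b, f (g y) = y) ∧
      ∀ w, fderiv ℝ g b w = 0 → w = 0 := by
  obtain ⟨Φ, hΦ, ha, hΦf⟩ := hf.exists_diffeo_of_injective h
  have hb : b ∈ Φ.target := by rw [← hab, ← hΦf]; exact Φ.map_source ha
  refine ⟨Φ.symm, hΦ.smoothNear_symm hb, ?_, ?_, fun w => hΦ.fderiv_symm_eq_zero_imp hb⟩
  · rw [← hab, ← hΦf, Φ.left_inv ha]
  · filter_upwards [Φ.eventually_right_inverse hb] with y hy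
    rw [← hΦf, hy]

end Diffeo

/-! ### Properties of `𝒜`-equivalence -/

theorem AEquivAt.symm {f g : ℝ × ℝ → E3} {p q : ℝ × ℝ} (h : AEquivAt f p g q) :
    AEquivAt g q f p := by
  obtain ⟨Φs, Φt, hs, ht, hp, hpq, hfp, hfg, hev⟩ := h
  have hq : q ∈ Φs.target := hpq ▸ Φs.map_source hp
  have hqp : Φs.symm q = p := by rw [← hpq, Φs.left_inv hp]
  refine ⟨Φs.symm, Φt.symm, hs.symm, ht.symm, hq, hqp, ?_, ?_, ?_⟩
  · rw [← hfg]; exact Φt.map_source hfp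
  · rw [← hfg, Φt.left_inv hfp]
  · have h1 : Tendsto Φs.symm (𝓝 q) (𝓝 p) := hqp ▸ Φs.symm.continuousAt hq
    filter_upwards [h1.eventually hev, Φs.eventually_right_inverse hq] with y hy hy'
    rw [hy'] at hy
    rw [← hy.2]
    exact ⟨Φt.map_source hy.1, Φt.left_inv hy.1⟩

theorem AEquivAt.trans {f g k : ℝ × ℝ → E3} {p q r : ℝ × ℝ} (h : AEquivAt f p g q)
    (h' : AEquivAt g q k r) : AEquivAt f p k r := by
  obtain ⟨Φs, Φt, hs, ht, hp, hpq, hfp, hfg, hev⟩ := h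
  obtain ⟨Ψs, Ψt, hs', ht', hq, hqr, hgq, hgk, hev'⟩ := h'
  refine ⟨Φs.trans Ψs, Φt.trans Ψt, hs.trans hs', ht.trans ht', ⟨hp, ?_⟩, ?_, ⟨hfp, ?_⟩, ?_, ?_⟩
  · change Φs p ∈ Ψs.source; rw [hpq]; exact hq
  · simp [hpq, hqr]
  · change Φt (f p) ∈ Ψt.source; rw [hfg]; exact hgq
  · simp [hfg, hgk]
  · have h1 : Tendsto Φs (𝓝 p) (𝓝 q) := hpq ▸ Φs.continuousAt hp
    filter_upwards [hev, h1.eventually hev'] with x hx hx'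
    refine ⟨⟨hx.1, ?_⟩, ?_⟩
    · change Φt (f x) ∈ Ψt.source; rw [hx.2]; exact hx'.1
    · simp [hx.2, hx'.2]

theorem aequivAt_of_eventuallyEq {f g : ℝ × ℝ → E3} {p : ℝ × ℝ} (h : f =ᶠ[𝓝 p] g) :
    AEquivAt f p g p := by
  refine ⟨.refl _, .refl _, isSmoothDiffeo_refl, isSmoothDiffeo_refl, mem_univ _, rfl,
    mem_univ _, h.self_of_nhds, ?_⟩
  filter_upwards [h] with x hx using ⟨mem_univ _, hx⟩

theorem aequivAt_target {f : ℝ × ℝ → E3} {p : ℝ × ℝ} (hf : ContinuousAt f p) {Ψ : E3 → E3}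
    (hΨ : SmoothNear Ψ (f p)) (h : ∀ w, fderiv ℝ Ψ (f p) w = 0 → w = 0) :
    AEquivAt f p (fun x => Ψ (f x)) p := by
  obtain ⟨Φ, hΦ, ha, hΦf⟩ := hΨ.exists_diffeo_of_injective h
  refine ⟨.refl _, Φ, isSmoothDiffeo_refl, hΦ, mem_univ _, rfl, ha, hΦf _, ?_⟩
  filter_upwards [hf.eventually (Φ.open_source.mem_nhds ha)] with x hx using ⟨hx, hΦf _⟩

/-- An explicit differentiable left inverse gives injectivity of the derivative by the chain rule,
which avoids computing any Jacobian of a target change. -/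
theorem aequivAt_target_of_leftInverse {f : ℝ × ℝ → E3} {p : ℝ × ℝ} (hf : ContinuousAt f p)
    {Ψ Ψ' : E3 → E3} (hΨ : SmoothNear Ψ (f p)) (hΨ' : DifferentiableAt ℝ Ψ' (Ψ (f p)))
    (h : ∀ᶠ z in 𝓝 (f p), Ψ' (Ψ z) = z) : AEquivAt f p (fun x => Ψ (f x)) p :=
  aequivAt_target hf hΨ fun _ => fderiv_eq_zero_imp_of_leftInverse hΨ.differentiableAt hΨ' h

theorem aequivAt_source (f : ℝ × ℝ → E3) {p q : ℝ × ℝ} {θ : ℝ × ℝ → ℝ × ℝ}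
    (hθ : SmoothNear θ q) (hqp : θ q = p) (h : ∀ w, fderiv ℝ θ q w = 0 → w = 0) :
    AEquivAt f p (fun y => f (θ y)) q := by
  obtain ⟨Φ, hΦ, ha, hΦf⟩ := hθ.exists_diffeo_of_injective h
  refine AEquivAt.symm ⟨Φ, .refl _, hΦ, isSmoothDiffeo_refl, ha, ?_, mem_univ _, ?_, ?_⟩
  · rw [hΦf, hqp]
  · simp [hqp]
  · exact Eventually.of_forall fun x => ⟨mem_univ _, by simp [hΦf]⟩

/-! ### A criterion for cuspidal edges -/

section Partial

variable {E : Type*} [NormedAddCommGroup E] [NormedSpace ℝ E]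

theorem eventuallyEq_dv {f g : ℝ × ℝ → E} {p : ℝ × ℝ} (h : f =ᶠ[𝓝 p] g) : dv f =ᶠ[𝓝 p] dv g :=
  h.fderiv.mono fun x hx => by rw [dv, dv, hx]

theorem dv_snd_mul {h : ℝ × ℝ → ℝ} {x : ℝ × ℝ} (hh : DifferentiableAt ℝ h x) :
    dv (fun y => y.2 * h y) x = h x + x.2 * dv h x := by
  rw [dv, fderiv_fun_mul differentiableAt_snd hh]
  simp [dv, fderiv_snd]
  ring

theorem SmoothNear.dv_snd_mul {h : ℝ × ℝ → ℝ} {p : ℝ × ℝ} (hh : SmoothNear h p) :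
    dv (fun y => y.2 * h y) =ᶠ[𝓝 p] fun x => h x + x.2 * dv h x :=
  hh.eventually_differentiableAt.mono fun _ hx => CuspidalEdge.dv_snd_mul hx

theorem SmoothNear.dv_add {g h : ℝ × ℝ → ℝ} {p : ℝ × ℝ} (hg : SmoothNear g p)
    (hh : SmoothNear h p) : dv (fun y => g y + h y) =ᶠ[𝓝 p] fun x => dv g x + dv h x := by
  filter_upwards [hg.eventually_differentiableAt, hh.eventually_differentiableAt] with x h1 h2
  rw [dv, fderiv_fun_add h1 h2]; rfl

/-- Second and third `v`-derivatives of `v * h`. -/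
theorem SmoothNear.dv_dv_snd_mul {h : ℝ × ℝ → ℝ} {p : ℝ × ℝ} (hh : SmoothNear h p) :
    dv (dv (fun y => y.2 * h y)) =ᶠ[𝓝 p] fun x => 2 * dv h x + x.2 * dv (dv h) x := by
  have hsnd := smoothNear_of_contDiff (contDiff_snd (𝕜 := ℝ) (E := ℝ) (F := ℝ) (n := ∞)) p
  have h1 := eventuallyEq_dv hh.dv_snd_mul
  have h2 := hh.dv_add (hsnd.mul hh.smoothNear_dv)
  filter_upwards [h1, h2, hh.smoothNear_dv.dv_snd_mul] with x e1 e2 e3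
  rw [e1, e2, e3]; ring

theorem SmoothNear.dv_dv_dv_snd_mul {h : ℝ × ℝ → ℝ} (hh : SmoothNear h 0) :
    dv (dv (dv (fun y => y.2 * h y))) 0 = 3 * dv (dv h) 0 := by
  have hsnd := smoothNear_of_contDiff (contDiff_snd (𝕜 := ℝ) (E := ℝ) (F := ℝ) (n := ∞)) 0
  have h1 := (eventuallyEq_dv hh.dv_dv_snd_mul).self_of_nhds
  have hd := hh.smoothNear_dv
  have h2 := (((smoothNear_const 2 0).mul hd).dv_add (hsnd.mul hd.smoothNear_dv)).self_of_nhds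
  have h3 : dv (fun y => 2 * dv h y) 0 = 2 * dv (dv h) 0 := by
    rw [dv, fderiv_const_mul hd.differentiableAt]; rfl
  have h4 := hd.smoothNear_dv.dv_snd_mul.self_of_nhds
  rw [h1, h2]
  simp only [h3, h4, Prod.snd_zero]
  ring

theorem SmoothNear.exists_eq_snd_mul {f : ℝ × ℝ → ℝ} (hf : SmoothNear f 0)
    (h0 : ∀ᶠ x in 𝓝 (0 : ℝ × ℝ), f (x.1, 0) = 0) : ∃ k : ℝ × ℝ → ℝ, SmoothNear k 0 ∧
      f =ᶠ[𝓝 (0 : ℝ × ℝ)] fun x => x.2 * k x := by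
  obtain ⟨k, hk, h1, -⟩ := hf.exists_eq_add_smul
  refine ⟨k, smoothNear_of_contDiff hk 0, ?_⟩
  filter_upwards [h1, h0] with x h1 h0
  rw [h1, h0, zero_add, smul_eq_mul]

end Partial

theorem dv_reflect {E : Type*} [NormedAddCommGroup E] [NormedSpace ℝ E] {s : ℝ × ℝ → E}
    {x : ℝ × ℝ} (hs : DifferentiableAt ℝ s (x.1, -x.2)) :
    dv (fun y => s (y.1, -y.2)) x = -dv s (x.1, -x.2) := by
  have h1 : HasFDerivAt (fun y : ℝ × ℝ => ((y.1, -y.2) : ℝ × ℝ))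
      ((ContinuousLinearMap.fst ℝ ℝ ℝ).prod (-ContinuousLinearMap.snd ℝ ℝ ℝ)) x :=
    hasFDerivAt_fst.prodMk hasFDerivAt_snd.neg
  have h2 : HasFDerivAt (fun y : ℝ × ℝ => s (y.1, -y.2)) _ x :=
    HasFDerivAt.comp (g := s) x hs.hasFDerivAt h1
  rw [dv, h2.fderiv]
  have e : ((0 : ℝ), (-1 : ℝ)) = -((0 : ℝ), (1 : ℝ)) := by simp
  simp [dv]
  rw [e, map_neg]

theorem dv_odd_part {g : ℝ × ℝ → ℝ} {x : ℝ × ℝ} (h1 : DifferentiableAt ℝ g x)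
    (h2 : DifferentiableAt ℝ g (x.1, -x.2)) :
    dv (fun y => 2⁻¹ * (g y - g (y.1, -y.2))) x = 2⁻¹ * (dv g x + dv g (x.1, -x.2)) := by
  have h3 : DifferentiableAt ℝ (fun y : ℝ × ℝ => g (y.1, -y.2)) x :=
    DifferentiableAt.comp (g := g) x h2 (by fun_prop)
  have h4 := dv_reflect h2
  rw [dv] at h4
  have h5 : HasFDerivAt (fun y => 2⁻¹ * (g y - g (y.1, -y.2))) _ x :=
    (h1.hasFDerivAt.sub h3.hasFDerivAt).const_mul 2⁻¹
  rw [dv, h5.fderiv]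
  simp only [smul_apply, sub_apply, smul_eq_mul, h4, dv]
  ring

theorem SmoothNear.reflect {s : ℝ × ℝ → ℝ} (hs : SmoothNear s 0) :
    SmoothNear (fun x : ℝ × ℝ => s (x.1, -x.2)) 0 := by
  have h1 : SmoothNear (fun x : ℝ × ℝ => ((x.1, -x.2) : ℝ × ℝ)) 0 :=
    smoothNear_of_contDiff (by fun_prop) 0
  exact SmoothNear.comp (g := s) (by simpa [Prod.mk_zero_zero] using hs) h1

/-- A smooth function `Z` with `Z_v` divisible by `v` splits as `Zₑ (u, v²) + v³ B (u, v²)`. -/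
theorem SmoothNear.exists_even_add_cube {Z s : ℝ × ℝ → ℝ} (hZ : SmoothNear Z 0)
    (hs : SmoothNear s 0) (hZs : dv Z =ᶠ[𝓝 0] fun x => x.2 * s x) (hs0 : dv s 0 ≠ 0) :
    ∃ A B : ℝ × ℝ → ℝ, ContDiff ℝ ∞ A ∧ ContDiff ℝ ∞ B ∧ B 0 ≠ 0 ∧
      ∀ᶠ x in 𝓝 (0 : ℝ × ℝ), Z x = A (x.1, x.2 ^ 2) + x.2 ^ 3 * B (x.1, x.2 ^ 2) := by
  have hhalf := smoothNear_const (2⁻¹ : ℝ) (0 : ℝ × ℝ)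
  have hZr := hZ.reflect
  obtain ⟨A, hA, hAx⟩ := (hhalf.mul (hZ.add hZr)).exists_comp_sq
    (Eventually.of_forall fun x => by simp only [neg_neg, Prod.mk.eta]; ring)
  -- The odd part of `Z` satisfies `O_v = v h`, where `h` is the odd part of `s`. As `h` vanishes on
  -- the axis, so do `O`, `O_v` and `O_vv`, and `O` can be divided by `v` three times.
  set O : ℝ × ℝ → ℝ := fun x => 2⁻¹ * (Z x - Z (x.1, -x.2)) with hO
  have hOs : SmoothNear O 0 := hhalf.mul (hZ.sub hZr)
  set h : ℝ × ℝ → ℝ := fun x => 2⁻¹ * (s x - s (x.1, -x.2)) with hh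
  have hhs : SmoothNear h 0 := hhalf.mul (hs.sub hs.reflect)
  have hdO : dv O =ᶠ[𝓝 0] fun x => x.2 * h x := by
    filter_upwards [hZ.eventually_differentiableAt,
      eventually_reflect hZ.eventually_differentiableAt, hZs, eventually_reflect hZs]
      with x h1 h3 h4 h5
    rw [dv_odd_part h1 h3, h4, h5, hh]
    ring
  have hdh : dv h 0 = dv s 0 := by
    have h3 : DifferentiableAt ℝ s (((0 : ℝ × ℝ).1, -(0 : ℝ × ℝ).2)) := by
      simpa [Prod.mk_zero_zero] using hs.differentiableAt
    rw [dv_odd_part hs.differentiableAt h3]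
    simp only [Prod.fst_zero, Prod.snd_zero, neg_zero, Prod.mk_zero_zero]
    ring
  obtain ⟨k₁, hk₁, hO₁⟩ := hOs.exists_eq_snd_mul
    (Eventually.of_forall fun x => by simp [hO])
  have hd1 := (eventuallyEq_dv hO₁).trans hk₁.dv_snd_mul
  obtain ⟨k₂, hk₂, hk₁₂⟩ := hk₁.exists_eq_snd_mul (by
    filter_upwards [eventually_axis hd1, eventually_axis hdO] with x e1 e2
    rw [e2] at e1; simpa using e1.symm)
  have hdd := eventuallyEq_dv hdO
  have hdd1 := (eventuallyEq_dv (eventuallyEq_dv hO₁)).trans hk₁.dv_dv_snd_mul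
  have hd2 := (eventuallyEq_dv hk₁₂).trans hk₂.dv_snd_mul
  obtain ⟨k₃, hk₃, hk₂₃⟩ := hk₂.exists_eq_snd_mul (by
    filter_upwards [eventually_axis hdd, eventually_axis hdd1, eventually_axis hd2,
      eventually_axis hhs.dv_snd_mul] with x e1 e2 e3 e4
    rw [e1, e4] at e2
    simp only [zero_mul, add_zero] at e2 e3
    rw [e3] at e2
    simpa [hh] using e2.symm)
  -- Compare third derivatives at the origin: `O_vvv = 6 k₃` from `O = v³ k₃`, and `O_vvv = 2 h_v =
  -- 2 s_v` from `O_v = v h`.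
  have hk₃0 : k₃ 0 ≠ 0 := by
    have e1 := (eventuallyEq_dv (eventuallyEq_dv (eventuallyEq_dv hO₁))).self_of_nhds
    rw [hk₁.dv_dv_dv_snd_mul, ((eventuallyEq_dv (eventuallyEq_dv hk₁₂)).trans
      hk₂.dv_dv_snd_mul).self_of_nhds] at e1
    simp only [((eventuallyEq_dv hk₂₃).trans hk₃.dv_snd_mul).self_of_nhds] at e1
    have e2 := ((eventuallyEq_dv (eventuallyEq_dv hdO)).trans hhs.dv_dv_snd_mul).self_of_nhds
    rw [e1] at e2
    simp only [hdh, Prod.snd_zero, zero_mul, add_zero] at e2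
    intro h0
    rw [h0] at e2
    apply hs0
    linarith
  have hO3 : ∀ᶠ x in 𝓝 (0 : ℝ × ℝ), O x = x.2 ^ 3 * k₃ x := by
    filter_upwards [hO₁, hk₁₂, hk₂₃] with x e1 e2 e3
    rw [e1, e2, e3]; ring
  obtain ⟨B, hB, hBx⟩ := hk₃.exists_comp_sq (by
    filter_upwards [hO3, eventually_reflect hO3] with x e1 e2
    by_cases hx : x.2 = 0
    · rw [hx, neg_zero, ← hx]
    · have e3 : O (x.1, -x.2) = -O x := by simp only [hO, neg_neg, Prod.mk.eta]; ring
      rw [e3, e1] at e2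
      have e4 : x.2 ^ 3 * (k₃ (x.1, -x.2) - k₃ x) = 0 := by
        linarith
      exact sub_eq_zero.1 ((mul_eq_zero.1 e4).resolve_left (pow_ne_zero 3 hx)))
  refine ⟨A, B, hA, hB, ?_, ?_⟩
  · have := hBx.self_of_nhds
    simp only [Prod.fst_zero, Prod.snd_zero, ne_eq, OfNat.ofNat_ne_zero, not_false_eq_true,
      zero_pow, Prod.mk_zero_zero] at this
    rwa [← this]
  · filter_upwards [hAx, hBx, hO3] with x e1 e2 e3
    rw [← e1, ← e2, ← e3, hO]
    ring

theorem vec3_ext {a b : E3} (h0 : a 0 = b 0) (h1 : a 1 = b 1) (h2 : a 2 = b 2) : a = b := by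
  ext i; fin_cases i <;> assumption

theorem smoothNear_coord (p : E3) (i : Fin 3) : SmoothNear (fun P : E3 => P i) p :=
  (smoothNear_id p).coord i

/-- In `Z = A(u, v²) + v³ B(u, v²)` the coefficients depend only on the first two components of the
map. So `A` can be subtracted and `B` divided out by a diffeomorphism of the target. -/
theorem aequivAt_standard_of_square {Z s : ℝ × ℝ → ℝ} (hZ : SmoothNear Z 0)
    (hs : SmoothNear s 0) (hZs : dv Z =ᶠ[𝓝 0] fun x => x.2 * s x) (hs0 : dv s 0 ≠ 0) :
    AEquivAt (fun x => !₂[x.1, x.2 ^ 2, Z x]) 0 standardCuspidalEdge 0 := by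
  obtain ⟨A, B, hA, hB, hB0, hZx⟩ := hZ.exists_even_add_cube hs hZs hs0
  set f : ℝ × ℝ → E3 := fun x => !₂[x.1, x.2 ^ 2, Z x] with hf
  have hfs : SmoothNear f 0 := smoothNear_vec3 (smoothNear_of_contDiff contDiff_fst 0)
    ((smoothNear_of_contDiff contDiff_snd 0).pow 2) hZ
  have hpair : ∀ P : E3, SmoothNear (fun P : E3 => (P 0, P 1)) P := fun P =>
    (smoothNear_coord P 0).prodMk (smoothNear_coord P 1)
  have hA' : ∀ P : E3, SmoothNear (fun P : E3 => A (P 0, P 1)) P := fun P =>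
    SmoothNear.comp (g := A) (smoothNear_of_contDiff hA _) (hpair P)
  have hB' : ∀ P : E3, SmoothNear (fun P : E3 => B (P 0, P 1)) P := fun P =>
    SmoothNear.comp (g := B) (smoothNear_of_contDiff hB _) (hpair P)
  have hBf : B (f 0 0, f 0 1) ≠ 0 := by simpa [hf, Prod.mk_zero_zero] using hB0
  refine (aequivAt_target_of_leftInverse hfs.continuousAt
    (Ψ := fun P => !₂[P 0, P 1, (P 2 - A (P 0, P 1)) / B (P 0, P 1)])
    (Ψ' := fun P => !₂[P 0, P 1, P 2 * B (P 0, P 1) + A (P 0, P 1)]) ?_ ?_ ?_).trans ?_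
  · exact smoothNear_vec3 (smoothNear_coord _ 0) (smoothNear_coord _ 1)
      (((smoothNear_coord _ 2).sub (hA' _)).div (hB' _) hBf)
  · exact (smoothNear_vec3 (smoothNear_coord _ 0) (smoothNear_coord _ 1)
      (((smoothNear_coord _ 2).mul (hB' _)).add (hA' _))).differentiableAt
  · filter_upwards [(hB' (f 0)).continuousAt.eventually_ne hBf] with P hP
    refine vec3_ext ?_ ?_ ?_
    · simp
    · simp
    · simp only [Matrix.cons_val]
      field_simp
      ring
  · refine aequivAt_of_eventuallyEq ?_
    have hBx : ∀ᶠ x in 𝓝 (0 : ℝ × ℝ), B (x.1, x.2 ^ 2) ≠ 0 := by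
      have : ContinuousAt (fun x : ℝ × ℝ => B (x.1, x.2 ^ 2)) 0 :=
        (hB.continuous.comp (by fun_prop)).continuousAt
      exact this.eventually_ne (by simpa [Prod.mk_zero_zero] using hB0)
    filter_upwards [hZx, hBx] with x h1 h2
    refine vec3_ext ?_ ?_ ?_
    · simp [hf, standardCuspidalEdge]
    · simp [hf, standardCuspidalEdge]
    · simp only [hf, standardCuspidalEdge, PiLp.toLp_apply, Matrix.cons_val]
      rw [h1]
      field_simp
      ring

theorem fderiv_pair_apply (f : ℝ × ℝ → ℝ) (x w : ℝ × ℝ) :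
    fderiv ℝ f x w = w.1 * du f x + w.2 * dv f x := by
  have e : w = w.1 • ((1 : ℝ), (0 : ℝ)) + w.2 • ((0 : ℝ), (1 : ℝ)) := by simp
  conv_lhs => rw [e]
  rw [map_add, map_smul, map_smul]
  rfl

/-- A function quadratic in `v` to leading order becomes `± v²` plus a function of `u`
in suitable coordinates `(u, V)`. -/
theorem aequivAt_standard_of_graph {Y Z s : ℝ × ℝ → ℝ} (hY : SmoothNear Y 0)
    (hZ : SmoothNear Z 0) (hs : SmoothNear s 0)
    (hY0 : ∀ᶠ x in 𝓝 (0 : ℝ × ℝ), dv Y (x.1, 0) = 0) (hYY : dv (dv Y) 0 ≠ 0)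
    (hZs : dv Z =ᶠ[𝓝 0] fun x => s x * dv Y x) (hs0 : dv s 0 ≠ 0) :
    AEquivAt (fun x => !₂[x.1, Y x, Z x]) 0 standardCuspidalEdge 0 := by
  have haxis : ∀ {p : ℝ × ℝ}, SmoothNear (fun x : ℝ × ℝ => ((x.1, 0) : ℝ × ℝ)) p :=
    smoothNear_of_contDiff (by fun_prop) _
  have hfst : ∀ {p : ℝ × ℝ}, SmoothNear (fun x : ℝ × ℝ => x.1) p :=
    smoothNear_of_contDiff contDiff_fst _
  have hsnd : ∀ {p : ℝ × ℝ}, SmoothNear (fun x : ℝ × ℝ => x.2) p :=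
    smoothNear_of_contDiff contDiff_snd _
  obtain ⟨k₁, hk₁, hY₁, hk₁Y⟩ := hY.exists_eq_add_smul
  replace hk₁ := smoothNear_of_contDiff hk₁ 0
  obtain ⟨k₂, hk₂, hk₁₂⟩ := hk₁.exists_eq_snd_mul (by
    filter_upwards [hk₁Y, hY0] with x e1 e2
    rw [e1, e2])
  have hY₂ : ∀ᶠ x in 𝓝 (0 : ℝ × ℝ), Y x = Y (x.1, 0) + x.2 ^ 2 * k₂ x := by
    filter_upwards [hY₁, hk₁₂] with x e1 e2
    rw [e1, e2, smul_eq_mul]; ring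
  have hYaxis : SmoothNear (fun x : ℝ × ℝ => Y (x.1, 0)) 0 :=
    SmoothNear.comp (g := Y) (by simpa [Prod.mk_zero_zero] using hY) haxis
  have hdvaxis : ∀ᶠ x in 𝓝 (0 : ℝ × ℝ), dv (fun x : ℝ × ℝ => Y (x.1, 0)) x = 0 := by
    filter_upwards [eventually_axis hY.eventually_differentiableAt] with x hx
    have h1 : HasFDerivAt (fun y : ℝ × ℝ => ((y.1, 0) : ℝ × ℝ))
        ((ContinuousLinearMap.fst ℝ ℝ ℝ).prod 0) x := hasFDerivAt_fst.prodMk (hasFDerivAt_const _ _)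
    have h2 : HasFDerivAt (fun y : ℝ × ℝ => Y (y.1, 0)) _ x :=
      HasFDerivAt.comp (g := Y) x hx.hasFDerivAt h1
    rw [dv, h2.fderiv]
    simp
    exact map_zero (fderiv ℝ Y (x.1, 0))
  have hk₂0 : k₂ 0 ≠ 0 := by
    have e1 : dv Y =ᶠ[𝓝 0] dv (fun x => x.2 * k₁ x) := by
      have h1 : Y =ᶠ[𝓝 0] fun x => Y (x.1, 0) + x.2 * k₁ x := hY₁
      filter_upwards [eventuallyEq_dv h1, hYaxis.dv_add (hsnd.mul hk₁), hdvaxis] with x h1 h2 h3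
      rw [h1, h2, h3, zero_add]
    have e2 := ((eventuallyEq_dv e1).trans hk₁.dv_dv_snd_mul).self_of_nhds
    have e3 := ((eventuallyEq_dv hk₁₂).trans hk₂.dv_snd_mul).self_of_nhds
    simp only [e3, Prod.snd_zero, zero_mul, add_zero] at e2
    intro h0
    rw [h0] at e2
    exact hYY (by linarith)
  -- `ε` is the sign of `k₂(0)`. With `V = v √(ε k₂)`, the expansion `Y = Y(u, 0) + v² k₂` becomes
  -- `Y(u, 0) + ε V²`.
  obtain ⟨ε, hε, hεk⟩ : ∃ ε : ℝ, ε * ε = 1 ∧ 0 < ε * k₂ 0 := by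
    rcases lt_or_gt_of_ne hk₂0 with h | h
    · exact ⟨-1, by norm_num, by linarith⟩
    · exact ⟨1, by norm_num, by linarith⟩
  set a : ℝ × ℝ → ℝ := fun x => √(ε * k₂ x) with ha
  have hεk₂ : SmoothNear (fun x => ε * k₂ x) 0 := (smoothNear_const ε 0).mul hk₂
  have has : SmoothNear a 0 := hεk₂.sqrt hεk.ne'
  have ha0 : a 0 ≠ 0 := (Real.sqrt_pos.2 hεk).ne'
  have hasq : ∀ᶠ x in 𝓝 (0 : ℝ × ℝ), k₂ x = ε * a x ^ 2 := by
    filter_upwards [hεk₂.continuousAt.eventually (lt_mem_nhds hεk)] with x hx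
    rw [ha, Real.sq_sqrt (le_of_lt hx), ← mul_assoc, hε, one_mul]
  have hV : SmoothNear (fun x : ℝ × ℝ => x.2 * a x) 0 := hsnd.mul has
  have hdV : ∀ w, fderiv ℝ (fun x : ℝ × ℝ => x.2 * a x) 0 w = a 0 * w.2 := fun w => by
    rw [fderiv_fun_mul differentiableAt_snd has.differentiableAt]
    simp [fderiv_snd]
  have hθ : SmoothNear (fun x : ℝ × ℝ => (x.1, x.2 * a x)) 0 := hfst.prodMk hV
  have hdθ : ∀ w, fderiv ℝ (fun x : ℝ × ℝ => (x.1, x.2 * a x)) 0 w = 0 → w = 0 := fun w hw => by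
    rw [DifferentiableAt.fderiv_prodMk differentiableAt_fst hV.differentiableAt] at hw
    simp only [fderiv_fst, ContinuousLinearMap.prod_apply, hdV, ContinuousLinearMap.coe_fst',
      Prod.mk_eq_zero, mul_eq_zero, ha0, false_or] at hw
    exact Prod.ext hw.1 hw.2
  obtain ⟨χ, hχ, hχ0, hθχ, hχinj⟩ := hθ.exists_inverse (b := 0) hdθ (by simp)
  have hχt : Tendsto χ (𝓝 0) (𝓝 0) := by
    simpa only [ContinuousAt, hχ0] using hχ.continuousAt
  have hχ1 : ∀ᶠ y in 𝓝 (0 : ℝ × ℝ), (χ y).1 = y.1 :=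
    hθχ.mono fun y hy => (Prod.ext_iff.1 hy).1
  have hχ2 : ∀ᶠ y in 𝓝 (0 : ℝ × ℝ), (χ y).2 * a (χ y) = y.2 :=
    hθχ.mono fun y hy => (Prod.ext_iff.1 hy).2
  have hξ : ∀ᶠ y in 𝓝 (0 : ℝ × ℝ), (dv χ y).1 = 0 := by
    have h1 : (fun y => (χ y).1) =ᶠ[𝓝 0] fun y => y.1 := hχ1
    filter_upwards [h1.fderiv (𝕜 := ℝ), hχ.eventually_differentiableAt] with y e1 e2
    have e3 : HasFDerivAt (fun y => (χ y).1) _ y := e2.hasFDerivAt.fst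
    rw [e3.fderiv, (hasFDerivAt_fst (𝕜 := ℝ) (E := ℝ) (F := ℝ) (p := y)).fderiv] at e1
    simpa [dv] using DFunLike.congr_fun e1 ((0 : ℝ), (1 : ℝ))
  have hchain : ∀ {f : ℝ × ℝ → ℝ}, SmoothNear f 0 →
      ∀ᶠ y in 𝓝 (0 : ℝ × ℝ), dv (fun y => f (χ y)) y = (dv χ y).2 * dv f (χ y) := by
    intro f hf
    filter_upwards [hχt.eventually hf.eventually_differentiableAt,
      hχ.eventually_differentiableAt, hξ] with y e1 e2 e3
    have e4 : HasFDerivAt (fun y => f (χ y)) _ y := e1.hasFDerivAt.comp y e2.hasFDerivAt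
    rw [dv, e4.fderiv, ContinuousLinearMap.comp_apply]
    change fderiv ℝ f (χ y) (dv χ y) = _
    rw [fderiv_pair_apply, e3, zero_mul, zero_add]
  have hYχ : (fun y => Y (χ y)) =ᶠ[𝓝 0] fun y => Y (y.1, 0) + y.2 * (ε * y.2) := by
    filter_upwards [hχt.eventually hY₂, hχt.eventually hasq, hχ1, hχ2] with y e1 e2 e3 e4
    rw [e1, e2, e3, ← e4]; ring
  have hεsnd : ∀ {p : ℝ × ℝ}, SmoothNear (fun x : ℝ × ℝ => ε * x.2) p :=
    (smoothNear_const ε _).mul hsnd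
  have hdYχ : dv (fun y => Y (χ y)) =ᶠ[𝓝 0] fun y => 2 * ε * y.2 := by
    filter_upwards [eventuallyEq_dv hYχ, hYaxis.dv_add (hsnd.mul hεsnd), hdvaxis,
      hεsnd.dv_snd_mul] with y e1 e2 e3 e4
    have e5 : dv (fun x : ℝ × ℝ => ε * x.2) y = ε := by
      rw [dv, fderiv_const_mul differentiableAt_snd, fderiv_snd]; simp
    rw [e1, e2, e3, e4, e5]; ring
  have hcomp : ∀ {f : ℝ × ℝ → ℝ}, SmoothNear f 0 → SmoothNear (fun y => f (χ y)) 0 :=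
    fun hf => SmoothNear.comp (by rwa [hχ0]) hχ
  have hτ : (dv χ 0).2 ≠ 0 := fun h0 => by
    have h1 := hχinj (0, 1) (Prod.ext hξ.self_of_nhds h0)
    simp at h1
  refine (aequivAt_source _ hχ hχ0 hχinj).trans ?_
  have hcont : SmoothNear (fun y => (!₂[(χ y).1, Y (χ y), Z (χ y)] : E3)) 0 :=
    smoothNear_vec3 hχ.fst (hcomp hY) (hcomp hZ)
  have hcoordY : ∀ P : E3, P 0 = 0 → SmoothNear (fun P : E3 => Y (P 0, 0)) P := fun P hP =>
    SmoothNear.comp (g := Y) (f := fun P : E3 => ((P 0, 0) : ℝ × ℝ))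
      (by rw [hP, Prod.mk_zero_zero]; exact hY) ((smoothNear_coord P 0).prodMk (smoothNear_const 0 P))
  -- In the coordinates `(u, V)` the relation `Z_V = s Y_V` reads `Z_V = V · 2 ε s`, which is the
  -- divisibility needed.
  have hst := aequivAt_standard_of_square (hcomp hZ)
    (s := fun y => 2 * ε * s (χ y)) ((smoothNear_const (2 * ε) 0).mul (hcomp hs)) (by
      filter_upwards [hchain hZ, hχt.eventually hZs, hchain hY, hdYχ] with y e1 e2 e3 e4
      rw [e1, e2, mul_left_comm, ← e3, e4]; ring) (by
      rw [dv, fderiv_const_mul (hcomp hs).differentiableAt]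
      change (2 * ε) * dv (fun y => s (χ y)) 0 ≠ 0
      rw [(hchain hs).self_of_nhds, hχ0]
      have hε0 : ε ≠ 0 := fun h => by simp [h] at hε
      exact mul_ne_zero (mul_ne_zero two_ne_zero hε0) (mul_ne_zero hτ hs0))
  refine AEquivAt.trans ?_ hst
  refine (aequivAt_target_of_leftInverse hcont.continuousAt
    (Ψ := fun P => !₂[P 0, ε * (P 1 - Y (P 0, 0)), P 2])
    (Ψ' := fun P => !₂[P 0, Y (P 0, 0) + ε * P 1, P 2]) ?_ ?_ ?_).trans ?_
  · exact smoothNear_vec3 (smoothNear_coord _ 0) ((smoothNear_const ε _).mul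
      ((smoothNear_coord _ 1).sub (hcoordY _ (by simp [hχ0])))) (smoothNear_coord _ 2)
  · exact (smoothNear_vec3 (smoothNear_coord _ 0) ((hcoordY _ (by simp [hχ0])).add
      ((smoothNear_const ε _).mul (smoothNear_coord _ 1))) (smoothNear_coord _ 2)).differentiableAt
  · refine Eventually.of_forall fun P => vec3_ext ?_ ?_ ?_
    · simp
    · simp only [Matrix.cons_val]
      rw [← mul_assoc, hε]; ring
    · simp
  · refine aequivAt_of_eventuallyEq ?_
    filter_upwards [hχ1, hYχ] with y e1 e2
    refine vec3_ext ?_ ?_ ?_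
    · simpa using e1
    · simp only [Matrix.cons_val]
      rw [e1, e2, add_sub_cancel_left]
      linear_combination y.2 ^ 2 * hε
    · simp

theorem exists_eq_smul_of_fderiv_eq_zero {X : ℝ × ℝ → ℝ} {p η w : ℝ × ℝ}
    (hX : fderiv ℝ X p ≠ 0) (hη0 : η ≠ 0) (hη : fderiv ℝ X p η = 0) (hw : fderiv ℝ X p w = 0) :
    ∃ t : ℝ, w = t • η := by
  rw [fderiv_pair_apply] at hη hw
  have hdet : w.1 * η.2 - w.2 * η.1 = 0 := by
    by_contra hne
    apply hX
    have h1 : du X p = 0 := by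
      refine (mul_eq_zero.1 ?_).resolve_left hne
      linear_combination η.2 * hw - w.2 * hη
    have h2 : dv X p = 0 := by
      refine (mul_eq_zero.1 ?_).resolve_left hne
      linear_combination w.1 * hη - η.1 * hw
    ext <;> simp [fderiv_pair_apply, h1, h2]
  by_cases h : η.1 = 0
  · have h2 : η.2 ≠ 0 := fun h2 => hη0 (Prod.ext h h2)
    refine ⟨w.2 / η.2, Prod.ext ?_ ?_⟩
    · rw [h, mul_zero, sub_zero] at hdet
      simp [h, (mul_eq_zero.1 hdet).resolve_right h2]
    · simp [h2]
  · refine ⟨w.1 / η.1, Prod.ext ?_ ?_⟩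
    · simp [h]
    · simp only [Prod.smul_snd, smul_eq_mul]
      field_simp
      linear_combination -hdet

theorem SmoothNear.fderiv_fderiv_apply {E F : Type*} [NormedAddCommGroup E] [NormedSpace ℝ E]
    [NormedAddCommGroup F] [NormedSpace ℝ F] {f : E → F} {p : E} (hf : SmoothNear f p) (w z : E) :
    fderiv ℝ (fun x => fderiv ℝ f x w) p z = fderiv ℝ (fderiv ℝ f) p z w := by
  have h : HasFDerivAt (fun x => fderiv ℝ f x w) _ p :=
    hf.smoothNear_fderiv.differentiableAt.hasFDerivAt.clm_apply (hasFDerivAt_const w p)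
  rw [h.fderiv]
  simp

/-- A front-like triple of functions of corank one, with a kernel direction transversal to the
singular curve, has a cuspidal edge. -/
theorem aequivAt_standard_of_coordinates {X Y Z r s : ℝ × ℝ → ℝ} {η : ℝ × ℝ}
    (hX : SmoothNear X 0) (hY : SmoothNear Y 0) (hZ : SmoothNear Z 0) (hs : SmoothNear s 0)
    (hX0 : X 0 = 0)
    (hrel : ∀ᶠ x in 𝓝 (0 : ℝ × ℝ), fderiv ℝ Z x = r x • fderiv ℝ X x + s x • fderiv ℝ Y x)
    (hdX : fderiv ℝ X 0 ≠ 0) (hdY : fderiv ℝ Y 0 = 0) (hη : fderiv ℝ X 0 η = 0)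
    (hYη : fderiv ℝ (fderiv ℝ Y) 0 η η ≠ 0) (hsη : fderiv ℝ s 0 η ≠ 0) :
    AEquivAt (fun x => !₂[X x, Y x, Z x]) 0 standardCuspidalEdge 0 := by
  have hη0 : η ≠ 0 := fun h => hsη (by rw [h, map_zero])
  -- The Jacobian of `(X, Y)`: its zero set is the singular curve. The proof shows `dJ(η) ≠ 0`, so
  -- `(X, J)` are coordinates in which this curve is the first axis and the second coordinate
  -- direction lies in `ker dX`.
  set J : ℝ × ℝ → ℝ := fun x => du X x * dv Y x - dv X x * du Y x with hJ
  have hJs : SmoothNear J 0 :=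
    (hX.smoothNear_du.mul hY.smoothNear_dv).sub (hX.smoothNear_dv.mul hY.smoothNear_du)
  have hduY : du Y 0 = 0 := by rw [du, hdY]; rfl
  have hdvY : dv Y 0 = 0 := by rw [dv, hdY]; rfl
  have hdJ : ∀ w, fderiv ℝ J 0 w
      = du X 0 * fderiv ℝ (dv Y) 0 w - dv X 0 * fderiv ℝ (du Y) 0 w := fun w => by
    have h1 := hX.smoothNear_du.differentiableAt
    have h2 := hX.smoothNear_dv.differentiableAt
    have h3 := hY.smoothNear_du.differentiableAt
    have h4 := hY.smoothNear_dv.differentiableAt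
    have h5 : HasFDerivAt J _ 0 :=
      (h1.hasFDerivAt.mul h4.hasFDerivAt).sub (h2.hasFDerivAt.mul h3.hasFDerivAt)
    rw [h5.fderiv]
    simp [hduY, hdvY]
  have hQ : fderiv ℝ (fderiv ℝ Y) 0 η η
      = η.1 * fderiv ℝ (du Y) 0 η + η.2 * fderiv ℝ (dv Y) 0 η := by
    have e1 : fderiv ℝ (du Y) 0 η = _ := hY.fderiv_fderiv_apply (1, 0) η
    have e2 : fderiv ℝ (dv Y) 0 η = _ := hY.fderiv_fderiv_apply (0, 1) η
    rw [e1, e2, ← smul_eq_mul, ← smul_eq_mul, ← map_smul, ← map_smul, ← map_add]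
    simp
  have hη' := hη
  rw [fderiv_pair_apply] at hη'
  -- If `dJ(η) = 0`, then together with `dX(η) = 0` this is a homogeneous linear system for `(X_u,
  -- X_v)` with determinant `±D²Y(η, η) ≠ 0`, forcing `dX = 0`.
  have hJη : fderiv ℝ J 0 η ≠ 0 := fun h0 => by
    rw [hdJ] at h0
    apply hdX
    have h1 : du X 0 = 0 := by
      refine (mul_eq_zero.1 ?_).resolve_right hYη
      rw [hQ]
      linear_combination η.2 * h0 + fderiv ℝ (du Y) 0 η * hη'
    have h2 : dv X 0 = 0 := by
      refine (mul_eq_zero.1 ?_).resolve_right hYη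
      rw [hQ]
      linear_combination -η.1 * h0 + fderiv ℝ (dv Y) 0 η * hη'
    ext <;> simp [fderiv_pair_apply, h1, h2]
  have hθ : SmoothNear (fun x => (X x, J x)) 0 := hX.prodMk hJs
  obtain ⟨χ, hχ, hχ0, hθχ, hχinj⟩ := hθ.exists_inverse (b := 0) (fun w hw => by
    rw [DifferentiableAt.fderiv_prodMk hX.differentiableAt hJs.differentiableAt] at hw
    simp only [ContinuousLinearMap.prod_apply, Prod.mk_eq_zero] at hw
    obtain ⟨t, rfl⟩ := exists_eq_smul_of_fderiv_eq_zero hdX hη0 hη hw.1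
    rw [map_smul, map_smul, smul_eq_mul, smul_eq_mul] at hw
    rw [(mul_eq_zero.1 hw.2).resolve_right hJη, zero_smul]) (by simp [hX0, hJ, hduY, hdvY])
  have hχt : Tendsto χ (𝓝 0) (𝓝 0) := by
    simpa only [ContinuousAt, hχ0] using hχ.continuousAt
  have hχ1 : ∀ᶠ y in 𝓝 (0 : ℝ × ℝ), X (χ y) = y.1 := hθχ.mono fun y hy => (Prod.ext_iff.1 hy).1
  have hχ2 : ∀ᶠ y in 𝓝 (0 : ℝ × ℝ), J (χ y) = y.2 := hθχ.mono fun y hy => (Prod.ext_iff.1 hy).2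
  have hchain : ∀ {f : ℝ × ℝ → ℝ}, SmoothNear f 0 →
      ∀ᶠ y in 𝓝 (0 : ℝ × ℝ), dv (fun y => f (χ y)) y = fderiv ℝ f (χ y) (dv χ y) := by
    intro f hf
    filter_upwards [hχt.eventually hf.eventually_differentiableAt,
      hχ.eventually_differentiableAt] with y e1 e2
    have e4 : HasFDerivAt (fun y => f (χ y)) _ y := e1.hasFDerivAt.comp y e2.hasFDerivAt
    rw [dv, e4.fderiv]
    rfl
  have hXξ : ∀ᶠ y in 𝓝 (0 : ℝ × ℝ), fderiv ℝ X (χ y) (dv χ y) = 0 := by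
    have h1 : (fun y => X (χ y)) =ᶠ[𝓝 0] fun y => y.1 := hχ1
    filter_upwards [eventuallyEq_dv h1, hchain hX] with y e1 e2
    rw [← e2, e1, dv, fderiv_fst]; rfl
  have hcomp : ∀ {f : ℝ × ℝ → ℝ}, SmoothNear f 0 → SmoothNear (fun y => f (χ y)) 0 :=
    fun hf => SmoothNear.comp (by rwa [hχ0]) hχ
  obtain ⟨t, ht⟩ := exists_eq_smul_of_fderiv_eq_zero hdX hη0 hη
    (by simpa [hχ0] using hXξ.self_of_nhds)
  have ht0 : t ≠ 0 := by
    rintro rfl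
    have h1 := hχinj (0, 1) (by rw [zero_smul] at ht; exact ht)
    simp at h1
  refine (aequivAt_source _ hχ hχ0 hχinj).trans ((aequivAt_of_eventuallyEq ?_).trans
    (aequivAt_standard_of_graph (hcomp hY) (hcomp hZ) (hcomp hs) ?_ ?_ ?_ ?_))
  · filter_upwards [hχ1] with y hy
    rw [hy]
  -- Where `J = 0` and `dX ≠ 0`, `dY` is a multiple of `dX` and so kills the direction `ξ`, which
  -- lies in `ker dX`.
  · have hX' : ∀ᶠ y in 𝓝 (0 : ℝ × ℝ), fderiv ℝ X (χ y) ≠ 0 :=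
      hχt.eventually (hX.smoothNear_fderiv.continuousAt.eventually_ne hdX)
    filter_upwards [eventually_axis hX', eventually_axis (hchain hY), eventually_axis hXξ,
      eventually_axis hχ2] with x e1 e2 e3 e4
    rw [e2]
    generalize χ (x.1, 0) = y at *
    generalize dv χ (x.1, 0) = ξ at *
    by_contra hne
    apply e1
    rw [fderiv_pair_apply] at e3 hne
    simp only [hJ] at e4
    have h1 : du X y = 0 := by
      refine (mul_eq_zero.1 ?_).resolve_right hne
      linear_combination ξ.2 * e4 + du Y y * e3
    have h2 : dv X y = 0 := by
      refine (mul_eq_zero.1 ?_).resolve_right hne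
      linear_combination -ξ.1 * e4 + dv Y y * e3
    ext <;> simp [fderiv_pair_apply, h1, h2]
  · have h1 : dv (fun y => Y (χ y)) =ᶠ[𝓝 0] fun y => fderiv ℝ Y (χ y) (dv χ y) := hchain hY
    have h2 : HasFDerivAt (fun y => fderiv ℝ Y (χ y))
        ((fderiv ℝ (fderiv ℝ Y) 0).comp (fderiv ℝ χ 0)) 0 := by
      refine HasFDerivAt.comp (g := fderiv ℝ Y) 0 ?_ hχ.differentiableAt.hasFDerivAt
      rw [hχ0]
      exact hY.smoothNear_fderiv.differentiableAt.hasFDerivAt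
    have h3 : HasFDerivAt (fun y => fderiv ℝ Y (χ y) (dv χ y)) _ 0 :=
      h2.clm_apply hχ.smoothNear_dv.differentiableAt.hasFDerivAt
    rw [(eventuallyEq_dv h1).self_of_nhds, dv, h3.fderiv]
    have ht' : fderiv ℝ χ 0 (0, 1) = t • η := ht
    simp only [hχ0, hdY, add_apply, ContinuousLinearMap.comp_apply, ContinuousLinearMap.flip_apply,
      zero_apply, zero_add, ht, ht', map_smul, smul_apply, smul_eq_mul]
    exact mul_ne_zero ht0 (mul_ne_zero ht0 hYη)
  · filter_upwards [hchain hZ, hchain hY, hχt.eventually hrel, hXξ] with y e1 e2 e3 e4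
    rw [e1, e2, e3]
    simp [e4]
  · rw [(hchain hs).self_of_nhds, hχ0, ht, map_smul]
    exact mul_ne_zero ht0 hsη

/-! ### Second-order properties of cuspidal edges -/

section SecondOrder

variable {E F : Type*} [NormedAddCommGroup E] [NormedSpace ℝ E]
  [NormedAddCommGroup F] [NormedSpace ℝ F]

/-- In the second-order chain rule the Hessian of `T` is evaluated on `dg(η) = 0` and drops out.
This makes `D²g(η, η)` modulo the image of `dg` invariant under target changes. -/
theorem SmoothNear.fderiv_fderiv_comp_of_kernel {g : E → F} {p η : E} {T : F → ℝ}
    (hg : SmoothNear g p) (hT : SmoothNear T (g p)) (hη : fderiv ℝ g p η = 0) :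
    fderiv ℝ (fderiv ℝ fun x => T (g x)) p η η
      = fderiv ℝ T (g p) (fderiv ℝ (fderiv ℝ g) p η η) := by
  rw [← (hT.comp hg).fderiv_fderiv_apply η η]
  have h1 : (fun x => fderiv ℝ (fun x => T (g x)) x η) =ᶠ[𝓝 p]
      fun x => fderiv ℝ T (g x) (fderiv ℝ g x η) := by
    filter_upwards [hg.eventually_differentiableAt,
      hg.continuousAt.eventually hT.eventually_differentiableAt] with x h1 h2
    have h3 : HasFDerivAt (fun x => T (g x)) _ x := h2.hasFDerivAt.comp x h1.hasFDerivAt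
    rw [h3.fderiv]; rfl
  have h2 : HasFDerivAt (fun x => fderiv ℝ T (g x))
      ((fderiv ℝ (fderiv ℝ T) (g p)).comp (fderiv ℝ g p)) p :=
    hT.smoothNear_fderiv.differentiableAt.hasFDerivAt.comp p hg.differentiableAt.hasFDerivAt
  have h3 : HasFDerivAt (fun x => fderiv ℝ T (g x) (fderiv ℝ g x η)) _ p :=
    h2.clm_apply (hg.fderiv_apply η).differentiableAt.hasFDerivAt
  rw [h1.fderiv_eq, h3.fderiv]
  simp [hη, hg.fderiv_fderiv_apply η η]

theorem SmoothNear.fderiv_fderiv_sq {b : E → ℝ} {p : E} (hb : SmoothNear b p) (h0 : b p = 0)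
    (η : E) : fderiv ℝ (fderiv ℝ fun x => b x ^ 2) p η η = 2 * fderiv ℝ b p η ^ 2 := by
  rw [← (hb.pow 2).fderiv_fderiv_apply η η]
  have h1 : (fun x => fderiv ℝ (fun x => b x ^ 2) x η) =ᶠ[𝓝 p]
      fun x => 2 * b x * fderiv ℝ b x η := by
    filter_upwards [hb.eventually_differentiableAt] with x h1
    rw [fderiv_fun_pow 2 h1]
    simp
  have h3 : HasFDerivAt (fun x => 2 * b x * fderiv ℝ b x η) _ p :=
    (hb.differentiableAt.hasFDerivAt.const_mul 2).mul
      (hb.fderiv_apply η).differentiableAt.hasFDerivAt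
  rw [h1.fderiv_eq, h3.fderiv]
  simp [h0]
  ring

end SecondOrder

theorem fderiv_coord_apply {E : Type*} [NormedAddCommGroup E] [NormedSpace ℝ E] {f : E → E3}
    {x : E} (hf : DifferentiableAt ℝ f x) (i : Fin 3) (w : E) :
    fderiv ℝ (fun y => f y i) x w = fderiv ℝ f x w i := by
  have h : HasFDerivAt (fun y => f y i) ((EuclideanSpace.proj i).comp (fderiv ℝ f x)) x :=
    (EuclideanSpace.proj i : E3 →L[ℝ] ℝ).hasFDerivAt.comp x hf.hasFDerivAt
  rw [h.fderiv]
  rfl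

/-- The first and second order data of a cuspidal edge. -/
theorem AEquivAt.corank_one {g : ℝ × ℝ → E3} {p : ℝ × ℝ} (hg : SmoothNear g p)
    (h : AEquivAt g p standardCuspidalEdge 0) :
    (∃ η ≠ 0, fderiv ℝ g p η = 0) ∧ fderiv ℝ g p ≠ 0 ∧
      ∀ η ≠ 0, fderiv ℝ g p η = 0 → ∀ w, fderiv ℝ (fderiv ℝ g) p η η ≠ fderiv ℝ g p w := by
  obtain ⟨Φs, Φt, hs, ht, hp, hp0, hgp, -, hev⟩ := h
  have hss := hs.smoothNear hp
  have hts := ht.smoothNear hgp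
  have hchain : ∀ i w, fderiv ℝ (fun P => Φt P i) (g p) (fderiv ℝ g p w)
      = fderiv ℝ (fun x => standardCuspidalEdge (Φs x) i) p w := fun i w => by
    have h1 : HasFDerivAt (fun x => Φt (g x) i) _ p :=
      (hts.coord i).differentiableAt.hasFDerivAt.comp p hg.differentiableAt.hasFDerivAt
    have h2 : (fun x => Φt (g x) i) =ᶠ[𝓝 p] fun x => standardCuspidalEdge (Φs x) i :=
      hev.mono fun x hx => by simp only [hx.2]
    rw [← h2.fderiv_eq, h1.fderiv]
    rfl
  have hb : SmoothNear (fun x => (Φs x).2) p := hss.snd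
  have hb0 : (Φs p).2 = 0 := by rw [hp0]; rfl
  have hd : ∀ w, fderiv ℝ Φs p w
      = (fderiv ℝ (fun x => (Φs x).1) p w, fderiv ℝ (fun x => (Φs x).2) p w) := fun w => by
    have h1 : HasFDerivAt (fun x => (Φs x).1) _ p := hss.differentiableAt.hasFDerivAt.fst
    have h2 : HasFDerivAt (fun x => (Φs x).2) _ p := hss.differentiableAt.hasFDerivAt.snd
    rw [h1.fderiv, h2.fderiv]
    rfl
  have h0 : ∀ w, fderiv ℝ (fun P => Φt P 0) (g p) (fderiv ℝ g p w)
      = fderiv ℝ (fun x => (Φs x).1) p w := fun w => by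
    rw [hchain]; simp [standardCuspidalEdge]
  have h1 : ∀ w, fderiv ℝ (fun P => Φt P 1) (g p) (fderiv ℝ g p w) = 0 := fun w => by
    rw [hchain]
    have : (fun x => standardCuspidalEdge (Φs x) 1) = fun x => (Φs x).2 ^ 2 := by
      ext x; simp [standardCuspidalEdge]
    rw [this, fderiv_fun_pow 2 hb.differentiableAt]
    simp [hb0]
  have h2 : ∀ w, fderiv ℝ (fun P => Φt P 2) (g p) (fderiv ℝ g p w) = 0 := fun w => by
    rw [hchain]
    have : (fun x => standardCuspidalEdge (Φs x) 2) = fun x => (Φs x).2 ^ 3 := by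
      ext x; simp [standardCuspidalEdge]
    rw [this, fderiv_fun_pow 3 hb.differentiableAt]
    simp [hb0]
  refine ⟨?_, ?_, ?_⟩
  · obtain ⟨η, hη⟩ := hs.exists_fderiv_eq hp (0, 1)
    refine ⟨η, ?_, ?_⟩
    · rintro rfl
      rw [map_zero] at hη
      exact zero_ne_one (congrArg Prod.snd hη)
    · refine ht.fderiv_eq_zero_imp hgp (vec3_ext ?_ ?_ ?_)
      · rw [← fderiv_coord_apply hts.differentiableAt, h0]
        rw [hd] at hη
        exact congrArg Prod.fst hη
      · rw [← fderiv_coord_apply hts.differentiableAt, h1]; rfl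
      · rw [← fderiv_coord_apply hts.differentiableAt, h2]; rfl
  · intro hz
    obtain ⟨w, hw⟩ := hs.exists_fderiv_eq hp (1, 0)
    have h3 := h0 w
    rw [hz, zero_apply, map_zero] at h3
    rw [hd, Prod.mk.injEq, ← h3] at hw
    exact zero_ne_one hw.1
  -- The second normalised component is `b²` with `b = (Φs).2` and `b(p) = 0`. If `D²g(η, η)` were
  -- in the image of `dg`, its differential would kill it, giving `2 db(η)² = 0`. The first
  -- component already gives `d(Φs).1(η) = 0`, so `η = 0`.
  · intro η hη0 hη w hw
    have h3 := hg.fderiv_fderiv_comp_of_kernel (hts.coord 1) hη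
    have h4 : (fun x => Φt (g x) 1) =ᶠ[𝓝 p] fun x => (Φs x).2 ^ 2 :=
      hev.mono fun x hx => by simp [hx.2, standardCuspidalEdge]
    rw [(h4.fderiv (𝕜 := ℝ)).fderiv_eq, hb.fderiv_fderiv_sq hb0, hw, h1] at h3
    have h5 : fderiv ℝ (fun x => (Φs x).2) p η = 0 := by
      have : fderiv ℝ (fun x => (Φs x).2) p η ^ 2 = 0 := by linarith
      exact pow_eq_zero_iff (two_ne_zero) |>.1 this
    have h6 := h0 η
    rw [hη, map_zero] at h6
    exact hη0 (hs.fderiv_eq_zero_imp hp (by rw [hd, h5, ← h6]; rfl))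

/-! ### Frames of Euclidean 3-space -/

/-- Pairing a linear relation with `n` isolates the coefficient of `q`. In use `a = F_u`, `b = ψ`,
and `q` is either the normal or `F + c`. -/
theorem linearIndependent_frame {a b q n : E3} (ha : a ≠ 0) (hb : ∀ t : ℝ, b ≠ t • a)
    (han : inner ℝ a n = 0) (hbn : inner ℝ b n = 0) (hqn : inner ℝ q n ≠ 0) :
    LinearIndependent ℝ ![b, a, q] := by
  rw [Fintype.linearIndependent_iff]
  intro t ht
  simp only [Fin.sum_univ_three, Matrix.cons_val] at ht
  have h2 : t 2 = 0 := by
    have := congrArg (fun x => inner ℝ x n) ht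
    simp only [inner_add_left, inner_smul_left, han, hbn, inner_zero_left, mul_zero, zero_add,
      RCLike.conj_to_real] at this
    exact (mul_eq_zero.1 this).resolve_right hqn
  rw [h2, zero_smul, add_zero] at ht
  have h0 : t 0 = 0 := by
    by_contra h
    refine hb (-(t 0)⁻¹ * t 1) ?_
    have h3 : t 0 • b = -(t 1 • a) := eq_neg_of_add_eq_zero_left ht
    calc b = (t 0)⁻¹ • (t 0 • b) := by rw [smul_smul, inv_mul_cancel₀ h, one_smul]
      _ = _ := by rw [h3, smul_neg, smul_smul, neg_mul, neg_smul]
  rw [h0, zero_smul, zero_add] at ht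
  have h1 : t 1 = 0 := (smul_eq_zero.1 ht).resolve_right ha
  intro i
  fin_cases i <;> assumption

theorem exists_dual_frame {a b q : E3} (h : LinearIndependent ℝ ![b, a, q]) :
    ∃ α β γ : E3 →L[ℝ] ℝ, (∀ x, x = α x • b + β x • a + γ x • q) ∧
      α a = 0 ∧ β a = 1 ∧ γ a = 0 ∧ β q = 0 ∧ γ q = 1 := by
  let B := basisOfLinearIndependentOfCardEqFinrank h (by simp)
  have hB : ⇑B = ![b, a, q] := coe_basisOfLinearIndependentOfCardEqFinrank h (by simp)
  have h1 : B 1 = a := by rw [hB]; rfl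
  have h2 : B 2 = q := by rw [hB]; rfl
  refine ⟨(B.coord 0).toContinuousLinearMap, (B.coord 1).toContinuousLinearMap,
    (B.coord 2).toContinuousLinearMap, fun x => ?_, ?_, ?_, ?_, ?_, ?_⟩
  · conv_lhs => rw [← B.sum_repr x]
    simp [Fin.sum_univ_three, hB]
  all_goals simp [← h1, ← h2]

theorem eq_zero_of_inner_frame {a b q x : E3} (h : LinearIndependent ℝ ![b, a, q])
    (ha : inner ℝ x a = 0) (hb : inner ℝ x b = 0) (hq : inner ℝ x q = 0) : x = 0 := by
  obtain ⟨α, β, γ, hx, -⟩ := exists_dual_frame h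
  have : inner ℝ x x = (0 : ℝ) := by
    conv_lhs => rw [hx x]
    rw [← hx x, hx x, inner_add_left, inner_add_left, inner_smul_left, inner_smul_left,
      inner_smul_left, ← hx x, real_inner_comm, hb, real_inner_comm, ha, real_inner_comm, hq]
    simp
  exact inner_self_eq_zero.1 this

/-! ### Fronts in adapted coordinates -/

/-- A front germ at the origin, with normal `n`, whose singular curve is the `u`-axis with null
direction `∂_v`, and which has the second-order data of a cuspidal edge at the origin. -/
structure AdaptedGerm (F n : ℝ × ℝ → E3) : Prop where
  smooth : SmoothNear F 0
  smooth_normal : SmoothNear n 0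
  norm_normal : ∀ᶠ x in 𝓝 (0 : ℝ × ℝ), ‖n x‖ = 1
  orthogonal : ∀ᶠ x in 𝓝 (0 : ℝ × ℝ), ∀ w, inner ℝ (fderiv ℝ F x w) (n x) = 0
  null : ∀ᶠ x in 𝓝 (0 : ℝ × ℝ), dv F (x.1, 0) = 0
  du_ne : du F 0 ≠ 0
  dv_dv_ne : ∀ t : ℝ, dv (dv F) 0 ≠ t • du F 0

theorem fderiv_inner_apply' {E : Type*} [NormedAddCommGroup E] [NormedSpace ℝ E] {f g : E → E3}
    {x : E} (hf : DifferentiableAt ℝ f x) (hg : DifferentiableAt ℝ g x) (w : E) :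
    fderiv ℝ (fun y => inner ℝ (f y) (g y)) x w
      = inner ℝ (f x) (fderiv ℝ g x w) + inner ℝ (fderiv ℝ f x w) (g x) :=
  fderiv_inner_apply ℝ hf hg w

namespace AdaptedGerm

variable {F n : ℝ × ℝ → E3}

theorem psi_zero (F : ℝ × ℝ → E3) : psi F 0 = dv (dv F) 0 := by simp [psi]

/-- The piecewise definition agrees near the origin with the Hadamard quotient of `F_v`, both on the
axis and off it. -/
theorem smooth_psi_and_dv_eq (H : AdaptedGerm F n) :
    SmoothNear (psi F) 0 ∧ ∀ᶠ x in 𝓝 (0 : ℝ × ℝ), dv F x = x.2 • psi F x := by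
  obtain ⟨k, hk, h1, h2⟩ := H.smooth.smoothNear_dv.exists_eq_add_smul
  have h3 : psi F =ᶠ[𝓝 0] k := by
    filter_upwards [h1, h2, H.null] with x h1 h2 h3
    rw [psi]
    split_ifs with hx
    · obtain ⟨a, b⟩ := x
      obtain rfl : b = 0 := hx
      exact h2.symm
    · rw [h1, h3, zero_add, smul_smul, inv_mul_cancel₀ hx, one_smul]
  refine ⟨(smoothNear_of_contDiff hk 0).congr h3, ?_⟩
  filter_upwards [h1, h3, H.null] with x h1 h3 h4
  rw [h1, h3, h4, zero_add]

theorem smooth_psi (H : AdaptedGerm F n) : SmoothNear (psi F) 0 := H.smooth_psi_and_dv_eq.1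

theorem dv_eq (H : AdaptedGerm F n) : ∀ᶠ x in 𝓝 (0 : ℝ × ℝ), dv F x = x.2 • psi F x := H.smooth_psi_and_dv_eq.2

theorem dv_zero (H : AdaptedGerm F n) : dv F 0 = 0 := by simpa using H.dv_eq.self_of_nhds

theorem second_fundamental (H : AdaptedGerm F n) : ∀ᶠ x in 𝓝 (0 : ℝ × ℝ), ∀ w z,
    inner ℝ (fderiv ℝ F x w) (fderiv ℝ n x z)
      + inner ℝ (fderiv ℝ (fderiv ℝ F) x z w) (n x) = 0 := by
  filter_upwards [H.smooth.eventually, H.smooth_normal.eventually_differentiableAt,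
    H.orthogonal.eventually_nhds] with x h1 h2 h3 w z
  have h4 : (fun y => inner ℝ (fderiv ℝ F y w) (n y)) =ᶠ[𝓝 x] fun _ => (0 : ℝ) :=
    h3.mono fun y hy => hy w
  have h5 := fderiv_inner_apply' (h1.fderiv_apply w).differentiableAt h2 z
  rw [h4.fderiv_eq, h1.fderiv_fderiv_apply] at h5
  simpa using h5.symm

theorem inner_fderiv_comm (H : AdaptedGerm F n) : ∀ᶠ x in 𝓝 (0 : ℝ × ℝ), ∀ w z,
    (inner ℝ (fderiv ℝ F x w) (fderiv ℝ n x z) : ℝ)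
      = inner ℝ (fderiv ℝ F x z) (fderiv ℝ n x w) := by
  filter_upwards [H.second_fundamental, H.smooth] with x h1 h2 w z
  have h3 := h1 w z
  have h4 := h1 z w
  rw [(h2.isSymmSndFDerivAt (by simpa using ENat.LEInfty.out (m := 2))) z w] at h3
  linarith

theorem inner_psi_normal_zero (H : AdaptedGerm F n) : inner ℝ (psi F 0) (n 0) = (0 : ℝ) := by
  have h := H.second_fundamental.self_of_nhds (0, 1) (0, 1)
  have h2 : fderiv ℝ F 0 (0, 1) = 0 := H.dv_zero
  have h3 : fderiv ℝ (fderiv ℝ F) 0 (0, 1) (0, 1) = psi F 0 := by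
    rw [psi_zero, ← H.smooth.fderiv_fderiv_apply]; rfl
  rw [h2, h3, inner_zero_left, zero_add] at h
  exact h

theorem inner_du_normal (H : AdaptedGerm F n) : ∀ᶠ x in 𝓝 (0 : ℝ × ℝ), inner ℝ (du F x) (n x) = (0 : ℝ) :=
  H.orthogonal.mono fun _ hx => hx _

/-- Symmetry of the second fundamental form moves the `v`-derivative onto `F`, where `F_v = v ψ`. -/
theorem inner_du_dv_normal (H : AdaptedGerm F n) : ∀ᶠ x in 𝓝 (0 : ℝ × ℝ),
    inner ℝ (du F x) (dv n x) = -(x.2 * hatM F n x) := by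
  filter_upwards [H.inner_fderiv_comm, H.dv_eq] with x h1 h2
  have h3 : (inner ℝ (du F x) (dv n x) : ℝ) = inner ℝ (dv F x) (du n x) := h1 _ _
  rw [h3, h2, inner_smul_left, hatM]
  simp

theorem linearIndependent (H : AdaptedGerm F n) {q : E3} (hq : inner ℝ q (n 0) ≠ (0 : ℝ)) :
    LinearIndependent ℝ ![psi F 0, du F 0, q] :=
  linearIndependent_frame H.du_ne (by rw [psi_zero]; exact H.dv_dv_ne)
    H.inner_du_normal.self_of_nhds H.inner_psi_normal_zero hq

theorem inner_normal_self (H : AdaptedGerm F n) : inner ℝ (n 0) (n 0) = (1 : ℝ) := by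
  rw [real_inner_self_eq_norm_sq, H.norm_normal.self_of_nhds]; norm_num

theorem inner_fderiv_normal (H : AdaptedGerm F n) : ∀ᶠ x in 𝓝 (0 : ℝ × ℝ), ∀ w,
    inner ℝ (fderiv ℝ n x w) (n x) = (0 : ℝ) := by
  filter_upwards [H.smooth_normal.eventually_differentiableAt, H.norm_normal.eventually_nhds]
    with x h1 h2 w
  have h3 : (fun y => inner ℝ (n y) (n y)) =ᶠ[𝓝 x] fun _ => (1 : ℝ) :=
    h2.mono fun y hy => by simp only [real_inner_self_eq_norm_sq, hy]; norm_num
  have h4 := fderiv_inner_apply' h1 h1 w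
  rw [h3.fderiv_eq, real_inner_comm] at h4
  simp only [fderiv_fun_const, Pi.zero_apply, zero_apply] at h4
  linarith

/-- On a front, `N̂` does not vanish. -/
theorem hatN_ne_zero (H : AdaptedGerm F n) (himm : dv n 0 ≠ 0) : hatN F n 0 ≠ 0 := by
  intro h0
  refine himm (eq_zero_of_inner_frame (H.linearIndependent (q := n 0) ?_) ?_ ?_ ?_)
  · rw [H.inner_normal_self]; exact one_ne_zero
  · rw [real_inner_comm, H.inner_du_dv_normal.self_of_nhds]; simp
  · rw [real_inner_comm]
    exact neg_eq_zero.1 h0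
  · exact H.inner_fderiv_normal.self_of_nhds _

theorem smooth_hatE (H : AdaptedGerm F n) : SmoothNear (hatE F) 0 := H.smooth.smoothNear_du.inner H.smooth.smoothNear_du

theorem smooth_hatF (H : AdaptedGerm F n) : SmoothNear (hatF F) 0 := H.smooth.smoothNear_du.inner H.smooth_psi

theorem smooth_hatG (H : AdaptedGerm F n) : SmoothNear (hatG F) 0 := H.smooth_psi.inner H.smooth_psi

theorem smooth_hatL (H : AdaptedGerm F n) : SmoothNear (hatL F n) 0 :=
  (H.smooth.smoothNear_du.inner H.smooth_normal.smoothNear_du).neg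

theorem smooth_hatM (H : AdaptedGerm F n) : SmoothNear (hatM F n) 0 :=
  (H.smooth_psi.inner H.smooth_normal.smoothNear_du).neg

theorem smooth_hatN (H : AdaptedGerm F n) : SmoothNear (hatN F n) 0 :=
  (H.smooth_psi.inner H.smooth_normal.smoothNear_dv).neg

end AdaptedGerm

/-! ### Principal curvature and ridge points through the numerator of the Gaussian curvature. -/

theorem smoothNear_fst {p : ℝ × ℝ} : SmoothNear (fun x : ℝ × ℝ => x.1) p :=
  smoothNear_of_contDiff contDiff_fst _

theorem smoothNear_snd {p : ℝ × ℝ} : SmoothNear (fun x : ℝ × ℝ => x.2) p :=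
  smoothNear_of_contDiff contDiff_snd _

/-- The numerator `L̂ N̂ - v M̂²` of the Gaussian curvature. -/
def hatK (F n : ℝ × ℝ → E3) (x : ℝ × ℝ) : ℝ :=
  hatL F n x * hatN F n x - x.2 * hatM F n x ^ 2

namespace AdaptedGerm

variable {F n : ℝ × ℝ → E3}

theorem smooth_hatK (H : AdaptedGerm F n) : SmoothNear (hatK F n) 0 :=
  (H.smooth_hatL.mul H.smooth_hatN).sub (smoothNear_snd.mul (H.smooth_hatM.pow 2))

theorem smooth_hatA (H : AdaptedGerm F n) : SmoothNear (hatA F n) 0 :=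
  ((H.smooth_hatE.mul H.smooth_hatN).sub ((((smoothNear_const 2 0).mul smoothNear_snd).mul
    H.smooth_hatF).mul H.smooth_hatM)).add ((smoothNear_snd.mul H.smooth_hatG).mul H.smooth_hatL)

theorem hatE_pos (H : AdaptedGerm F n) : 0 < hatE F 0 := real_inner_self_pos.2 H.du_ne

theorem hatA_zero (F n : ℝ × ℝ → E3) : hatA F n 0 = hatE F 0 * hatN F n 0 := by simp [hatA]

/-- The equality case of Cauchy–Schwarz: a zero Gram determinant would make `ψ` equal to its
projection `(F̂/Ê) F_u`. -/
theorem discr_ne_zero (H : AdaptedGerm F n) : hatE F 0 * hatG F 0 - hatF F 0 ^ 2 ≠ 0 := by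
  intro h0
  have hE := H.hatE_pos.ne'
  refine H.dv_dv_ne (hatF F 0 / hatE F 0) ?_
  rw [← psi_zero, ← sub_eq_zero, ← inner_self_eq_zero (𝕜 := ℝ)]
  rw [inner_sub_left, inner_sub_right, inner_sub_right, inner_smul_left, inner_smul_right,
    inner_smul_left, inner_smul_right,
    real_inner_comm (du F 0) (psi F 0), RCLike.conj_to_real]
  change hatG F 0 - hatF F 0 / hatE F 0 * hatF F 0
    - (hatF F 0 / hatE F 0 * hatF F 0
      - hatF F 0 / hatE F 0 * (hatF F 0 / hatE F 0 * hatE F 0)) = 0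
  field_simp
  linear_combination h0

/-- The radicand in the definition of `B̂`. -/
def radicand (F n : ℝ × ℝ → E3) (x : ℝ × ℝ) : ℝ :=
  hatA F n x ^ 2 - 4 * x.2 * (hatE F x * hatG F x - hatF F x ^ 2) * hatK F n x

theorem smooth_radicand (H : AdaptedGerm F n) : SmoothNear (radicand F n) 0 :=
  (H.smooth_hatA.pow 2).sub ((((smoothNear_const 4 0).mul smoothNear_snd).mul
    ((H.smooth_hatE.mul H.smooth_hatG).sub (H.smooth_hatF.pow 2))).mul H.smooth_hatK)

/-- Multiplying numerator and denominator by `Â + B̂` removes the division by `v`. At the origin `Â`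
and the radicand are positive, so the new expression is smooth there. -/
theorem hatKappa₂_eq (H : AdaptedGerm F n) (hN : 0 < hatN F n 0) :
    hatKappa₂ F n =ᶠ[𝓝 0] fun x => 2 * hatK F n x / (hatA F n x + √(radicand F n x)) := by
  have hA0 : 0 < hatA F n 0 := by rw [hatA_zero]; exact mul_pos H.hatE_pos hN
  have hR0 : 0 < radicand F n 0 := by simp only [radicand, Prod.snd_zero]; nlinarith
  have hD := ((H.smooth_hatE.mul H.smooth_hatG).sub (H.smooth_hatF.pow 2)).continuousAt.eventually_ne
    H.discr_ne_zero
  filter_upwards [H.smooth_hatA.continuousAt.eventually (lt_mem_nhds hA0),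
    H.smooth_radicand.continuousAt.eventually (lt_mem_nhds hR0), hD] with x h1 h2 h3
  have hB : hatB F n x = √(radicand F n x) := rfl
  rw [hatKappa₂]
  split_ifs with hx
  · rw [hB]; rfl
  · have h4 : 0 < hatA F n x + √(radicand F n x) := add_pos_of_pos_of_nonneg h1 (Real.sqrt_nonneg _)
    rw [hB, div_eq_div_iff (mul_ne_zero (mul_ne_zero two_ne_zero hx) h3) h4.ne']
    have h5 := Real.sq_sqrt (le_of_lt h2)
    have h6 : (hatA F n x - √(radicand F n x)) * (hatA F n x + √(radicand F n x))
        = hatA F n x ^ 2 - radicand F n x := by linear_combination -h5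
    rw [h6, radicand]
    ring

/-- Here `κ̂₂ = 2K / S` with `S(0) ≠ 0` and `K(0) = L̂ N̂`. Once `κ̂₂` vanishes at the origin, the
principal direction reduces to `(N̂, -M̂)` and the derivative of the quotient to `2 dK / S`. -/
theorem hatKappa₂_condition_iff (H : AdaptedGerm F n) (hN : 0 < hatN F n 0) :
    (hatKappa₂ F n 0 = 0 ∧ ¬ IsRidgePoint F n 0) ↔
      hatL F n 0 = 0 ∧ fderiv ℝ (hatK F n) 0 (hatN F n 0, -hatM F n 0) ≠ 0 := by
  have hA0 : 0 < hatA F n 0 := by rw [hatA_zero]; exact mul_pos H.hatE_pos hN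
  have hR0 : 0 < radicand F n 0 := by simp only [radicand, Prod.snd_zero]; nlinarith
  have hκ := H.hatKappa₂_eq hN
  set S : ℝ × ℝ → ℝ := fun x => hatA F n x + √(radicand F n x) with hS
  have hSs : SmoothNear S 0 := H.smooth_hatA.add (H.smooth_radicand.sqrt hR0.ne')
  have hS0 : S 0 ≠ 0 := (add_pos_of_pos_of_nonneg hA0 (Real.sqrt_nonneg _)).ne'
  have hK0 : hatK F n 0 = hatL F n 0 * hatN F n 0 := by simp [hatK]
  have h1 : hatKappa₂ F n 0 = 0 ↔ hatL F n 0 = 0 := by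
    rw [hκ.self_of_nhds]
    change 2 * hatK F n 0 / S 0 = 0 ↔ _
    rw [div_eq_zero_iff, or_iff_left hS0, hK0]
    simp [hN.ne']
  rw [h1]
  refine and_congr_right fun hL => ?_
  have hK0' : hatK F n 0 = 0 := by rw [hK0, hL, zero_mul]
  have hdir : hatDirection F n 0 = (hatN F n 0, -hatM F n 0) := by
    simp [hatDirection, h1.2 hL]
  rw [IsRidgePoint, hdir, hκ.fderiv_eq]
  have h2 : HasFDerivAt (fun x => 2 * hatK F n x * (S x)⁻¹) _ 0 :=
    (H.smooth_hatK.differentiableAt.hasFDerivAt.const_mul 2).mul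
      (hSs.differentiableAt.inv hS0).hasFDerivAt
  have h3 : (fun x => 2 * hatK F n x / (hatA F n x + √(radicand F n x)))
      = fun x => 2 * hatK F n x * (S x)⁻¹ := by
    ext x; rw [div_eq_mul_inv]
  rw [h3, h2.fderiv]
  simp [hK0', hS0]

end AdaptedGerm

/-! ### The polar dual -/

/-- The support function `⟨F + c, n⟩`. -/
def support (F n : ℝ × ℝ → E3) (c : E3) (x : ℝ × ℝ) : ℝ := inner ℝ (F x + c) (n x)

/-- The polar dual surface `n / ⟨F + c, n⟩`, the inversion of the dual surface. -/
def polarDual (F n : ℝ × ℝ → E3) (c : E3) (x : ℝ × ℝ) : E3 := (support F n c x)⁻¹ • n x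

namespace AdaptedGerm

variable {F n : ℝ × ℝ → E3} {c : E3}

theorem smooth_add_const (H : AdaptedGerm F n) (c : E3) : SmoothNear (fun x => F x + c) 0 :=
  H.smooth.add (smoothNear_const c 0)

theorem smooth_support (H : AdaptedGerm F n) (c : E3) : SmoothNear (support F n c) 0 :=
  (H.smooth_add_const c).inner H.smooth_normal

theorem smooth_inv_support (H : AdaptedGerm F n) (hc : support F n c 0 ≠ 0) :
    SmoothNear (fun x => (support F n c x)⁻¹) 0 :=
  ((smoothNear_const 1 0).div (H.smooth_support c) hc).congr
    (Eventually.of_forall fun x => by simp)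

theorem smooth_polarDual (H : AdaptedGerm F n) (hc : support F n c 0 ≠ 0) :
    SmoothNear (polarDual F n c) 0 :=
  (H.smooth_inv_support hc).smul H.smooth_normal

theorem fderiv_polarDual (H : AdaptedGerm F n) (hc : support F n c 0 ≠ 0) :
    ∀ᶠ x in 𝓝 (0 : ℝ × ℝ), ∀ w, fderiv ℝ (polarDual F n c) x w
      = (support F n c x)⁻¹ • fderiv ℝ n x w
        + fderiv ℝ (fun x => (support F n c x)⁻¹) x w • n x := by
  filter_upwards [H.smooth_normal.eventually_differentiableAt,
    (H.smooth_inv_support hc).eventually_differentiableAt] with x h1 h2 w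
  have h3 : HasFDerivAt (polarDual F n c) _ x := h2.hasFDerivAt.smul h1.hasFDerivAt
  rw [h3.fderiv]
  simp

theorem inner_fderiv_polarDual_du (H : AdaptedGerm F n) (hc : support F n c 0 ≠ 0) :
    ∀ᶠ x in 𝓝 (0 : ℝ × ℝ), ∀ w : ℝ × ℝ,
      inner ℝ (fderiv ℝ (polarDual F n c) x w) (du F x)
        = -(w.1 * hatL F n x + w.2 * (x.2 * hatM F n x)) * (support F n c x)⁻¹ := by
  filter_upwards [H.fderiv_polarDual hc, H.inner_du_normal, H.inner_du_dv_normal]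
    with x h1 h2 h3 w
  have e : w = w.1 • ((1 : ℝ), (0 : ℝ)) + w.2 • ((0 : ℝ), (1 : ℝ)) := by simp
  have h4 : fderiv ℝ n x w = w.1 • du n x + w.2 • dv n x := by
    conv_lhs => rw [e]
    rw [map_add, map_smul, map_smul]; rfl
  have h5 : inner ℝ (du F x) (du n x) = -hatL F n x := by rw [hatL, neg_neg]
  rw [h1, real_inner_comm, inner_add_right, inner_smul_right, inner_smul_right, h2, h4,
    inner_add_right, inner_smul_right, inner_smul_right, h3, h5]
  ring

theorem inner_fderiv_polarDual_psi (H : AdaptedGerm F n) (hc : support F n c 0 ≠ 0) (w : ℝ × ℝ) :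
    inner ℝ (fderiv ℝ (polarDual F n c) 0 w) (psi F 0)
      = -(w.1 * hatM F n 0 + w.2 * hatN F n 0) * (support F n c 0)⁻¹ := by
  have e : w = w.1 • ((1 : ℝ), (0 : ℝ)) + w.2 • ((0 : ℝ), (1 : ℝ)) := by simp
  have h4 : fderiv ℝ n 0 w = w.1 • du n 0 + w.2 • dv n 0 := by
    conv_lhs => rw [e]
    rw [map_add, map_smul, map_smul]; rfl
  have h5 : inner ℝ (psi F 0) (du n 0) = -hatM F n 0 := by rw [hatM, neg_neg]
  have h6 : inner ℝ (psi F 0) (dv n 0) = -hatN F n 0 := by rw [hatN, neg_neg]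
  rw [(H.fderiv_polarDual hc).self_of_nhds, real_inner_comm, inner_add_right, inner_smul_right,
    inner_smul_right, H.inner_psi_normal_zero, h4, inner_add_right, inner_smul_right,
    inner_smul_right, h5, h6]
  ring

/-- Differentiate `⟨F + c, G⟩ = 1`; the term `⟨dF, G⟩` vanishes because `G` is a multiple of `n`.
Thus `F + c` is normal to the polar dual. -/
theorem inner_fderiv_polarDual_position (H : AdaptedGerm F n) (hc : support F n c 0 ≠ 0) :
    ∀ᶠ x in 𝓝 (0 : ℝ × ℝ), ∀ w : ℝ × ℝ,
      inner ℝ (fderiv ℝ (polarDual F n c) x w) (F x + c) = (0 : ℝ) := by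
  have h0 : (fun x => inner ℝ (F x + c) (polarDual F n c x)) =ᶠ[𝓝 0] fun _ => (1 : ℝ) := by
    filter_upwards [(H.smooth_support c).continuousAt.eventually_ne hc] with x hx
    rw [polarDual, inner_smul_right]
    exact inv_mul_cancel₀ hx
  filter_upwards [h0.eventuallyEq_nhds, H.orthogonal, H.smooth.eventually_differentiableAt,
    (H.smooth_polarDual hc).eventually_differentiableAt] with x h1 h2 h3 h4 w
  have h5 := fderiv_inner_apply' (h3.add_const c) h4 w
  rw [h1.fderiv_eq, fderiv_add_const, polarDual, inner_smul_right, h2 w, real_inner_comm] at h5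
  simpa using h5.symm

theorem linearIndependent_position (H : AdaptedGerm F n) (hc : support F n c 0 ≠ 0) :
    LinearIndependent ℝ ![psi F 0, du F 0, F 0 + c] :=
  H.linearIndependent hc

theorem fderiv_polarDual_kernel (H : AdaptedGerm F n) (hc : support F n c 0 ≠ 0)
    (hL : hatL F n 0 = 0) :
    fderiv ℝ (polarDual F n c) 0 (hatN F n 0, -hatM F n 0) = 0 := by
  refine eq_zero_of_inner_frame (H.linearIndependent_position hc) ?_ ?_ ?_
  · rw [(H.inner_fderiv_polarDual_du hc).self_of_nhds, hL]; simp
  · rw [H.inner_fderiv_polarDual_psi hc]; ring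
  · exact (H.inner_fderiv_polarDual_position hc).self_of_nhds _

theorem inner_fderiv_fderiv_polarDual_position (H : AdaptedGerm F n)
    (hc : support F n c 0 ≠ 0) {η : ℝ × ℝ} (hη : fderiv ℝ (polarDual F n c) 0 η = 0) :
    inner ℝ (fderiv ℝ (fderiv ℝ (polarDual F n c)) 0 η η) (F 0 + c) = (0 : ℝ) := by
  have hG := H.smooth_polarDual hc
  have h1 : (fun x => inner ℝ (fderiv ℝ (polarDual F n c) x η) (F x + c)) =ᶠ[𝓝 0]
      fun _ => (0 : ℝ) := (H.inner_fderiv_polarDual_position hc).mono fun x hx => hx η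
  have h2 := fderiv_inner_apply' (hG.fderiv_apply η).differentiableAt
    (H.smooth_add_const c).differentiableAt η
  rw [h1.fderiv_eq, hη, inner_zero_left, zero_add, hG.fderiv_fderiv_apply] at h2
  simpa using h2.symm

/-- Differentiate the formula for `⟨dG(η), F_u⟩` along the constant vector `η`; the derivative of
`F_u` is paired with `dG(η) = 0`. Since `L̂ = 0` and `v = 0`, both this derivative times `-h` and
`dK(η)` equal `N̂ dL̂(η) + M̂³`. -/
theorem inner_fderiv_fderiv_polarDual_du (H : AdaptedGerm F n) (hc : support F n c 0 ≠ 0)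
    (hL : hatL F n 0 = 0) :
    inner ℝ (fderiv ℝ (fderiv ℝ (polarDual F n c)) 0 (hatN F n 0, -hatM F n 0)
        (hatN F n 0, -hatM F n 0)) (du F 0)
      = -fderiv ℝ (hatK F n) 0 (hatN F n 0, -hatM F n 0) * (support F n c 0)⁻¹ := by
  have hη := H.fderiv_polarDual_kernel hc hL
  set η : ℝ × ℝ := (hatN F n 0, -hatM F n 0) with hηdef
  have hG := H.smooth_polarDual hc
  have h1 : (fun x => inner ℝ (fderiv ℝ (polarDual F n c) x η) (du F x)) =ᶠ[𝓝 0]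
      fun x => -(η.1 * hatL F n x + η.2 * (x.2 * hatM F n x)) * (support F n c x)⁻¹ :=
    (H.inner_fderiv_polarDual_du hc).mono fun x hx => hx η
  have h2 := fderiv_inner_apply' (hG.fderiv_apply η).differentiableAt
    H.smooth.smoothNear_du.differentiableAt η
  rw [hη, inner_zero_left, zero_add, hG.fderiv_fderiv_apply] at h2
  have dL := H.smooth_hatL.differentiableAt.hasFDerivAt
  have dM := H.smooth_hatM.differentiableAt.hasFDerivAt
  have dN := H.smooth_hatN.differentiableAt.hasFDerivAt
  have h3 : HasFDerivAt (fun x => -(η.1 * hatL F n x + η.2 * (x.2 * hatM F n x)) *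
      (support F n c x)⁻¹) _ 0 :=
    (((dL.const_mul η.1).add ((hasFDerivAt_snd.mul dM).const_mul η.2)).neg).mul
      (H.smooth_inv_support hc).differentiableAt.hasFDerivAt
  have h4 : HasFDerivAt (hatK F n) _ 0 := (dL.mul dN).sub (hasFDerivAt_snd.mul (dM.pow 2))
  rw [← h2, h1.fderiv_eq, h3.fderiv, h4.fderiv]
  simp [hL, hηdef]
  ring

theorem exists_fderiv_polarDual_eq (H : AdaptedGerm F n) (hc : support F n c 0 ≠ 0)
    (hN : hatN F n 0 ≠ 0) {z : E3} (h1 : inner ℝ z (du F 0) = (0 : ℝ))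
    (h2 : inner ℝ z (F 0 + c) = (0 : ℝ)) : ∃ w, z = fderiv ℝ (polarDual F n c) 0 w := by
  -- Along `∂_v` the derivative of `G` pairs to zero with `F_u` and `F + c`, and to `-N̂ / h` with
  -- `ψ`. The multiple is chosen to match the only remaining component of `z`.
  refine ⟨(0, -(inner ℝ z (psi F 0) * support F n c 0 / hatN F n 0)), ?_⟩
  rw [← sub_eq_zero]
  refine eq_zero_of_inner_frame (H.linearIndependent_position hc) ?_ ?_ ?_
  · rw [inner_sub_left, h1, (H.inner_fderiv_polarDual_du hc).self_of_nhds]; simp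
  · rw [inner_sub_left, H.inner_fderiv_polarDual_psi hc]
    field_simp
    simp
  · rw [inner_sub_left, h2, (H.inner_fderiv_polarDual_position hc).self_of_nhds, sub_zero]

/-- Expand the moving normal `F + c` in the frame frozen at the origin and solve `⟨dG, F + c⟩ = 0`
for the last component, so that `s = -β/γ`. As `dF(η) = N̂ F_u`, the `F_u`-coordinate of the normal
grows at rate `N̂` along `η`; this is the front property of `G`. -/
theorem exists_relation (H : AdaptedGerm F n) (hc : support F n c 0 ≠ 0) :
    ∃ r s : ℝ × ℝ → ℝ, SmoothNear s 0 ∧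
      fderiv ℝ s 0 (hatN F n 0, -hatM F n 0) = -hatN F n 0 ∧
      ∀ᶠ x in 𝓝 (0 : ℝ × ℝ), ∀ w,
        (inner ℝ (fderiv ℝ (polarDual F n c) x w) (F 0 + c) : ℝ)
          = r x * inner ℝ (fderiv ℝ (polarDual F n c) x w) (psi F 0)
            + s x * inner ℝ (fderiv ℝ (polarDual F n c) x w) (du F 0) := by
  obtain ⟨α, β, γ, hx, hαa, hβa, hγa, hβq, hγq⟩ :=
    exists_dual_frame (H.linearIndependent_position hc)
  have hQ := H.smooth_add_const c
  have hcomp : ∀ δ : E3 →L[ℝ] ℝ, SmoothNear (fun x => δ (F x + c)) 0 := fun δ =>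
    SmoothNear.comp (g := δ) (smoothNear_clm δ _) hQ
  have hγ0 : γ (F 0 + c) ≠ 0 := by rw [hγq]; exact one_ne_zero
  refine ⟨fun x => -α (F x + c) / γ (F x + c), fun x => -β (F x + c) / γ (F x + c),
    (hcomp β).neg.div (hcomp γ) hγ0, ?_, ?_⟩
  · have hdF : fderiv ℝ F 0 (hatN F n 0, -hatM F n 0) = hatN F n 0 • du F 0 := by
      have e : ((hatN F n 0, -hatM F n 0) : ℝ × ℝ)
          = hatN F n 0 • ((1 : ℝ), (0 : ℝ)) + (-hatM F n 0) • ((0 : ℝ), (1 : ℝ)) := by simp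
      have h0 : fderiv ℝ F 0 (0, 1) = 0 := H.dv_zero
      rw [e, map_add, map_smul, map_smul, h0, smul_zero, add_zero]
      rfl
    have hd : ∀ δ : E3 →L[ℝ] ℝ, HasFDerivAt (fun x => δ (F x + c)) (δ.comp (fderiv ℝ F 0)) 0 :=
      fun δ => δ.hasFDerivAt.comp (0 : ℝ × ℝ) (H.smooth.differentiableAt.hasFDerivAt.add_const c)
    have h1 : HasFDerivAt (fun x => -β (F x + c) * (γ (F x + c))⁻¹) _ 0 :=
      (hd β).neg.mul ((hcomp γ).differentiableAt.inv hγ0).hasFDerivAt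
    simp only [div_eq_mul_inv]
    rw [h1.fderiv]
    simp only [add_apply, smul_apply, neg_apply, Pi.neg_apply, ContinuousLinearMap.comp_apply, hdF, map_smul,
      hβa, hβq, hγq, smul_eq_mul]
    ring
  · filter_upwards [H.inner_fderiv_polarDual_position hc,
      (hcomp γ).continuousAt.eventually_ne hγ0] with x h1 h2 w
    have h3 := h1 w
    rw [hx (F x + c), inner_add_right, inner_add_right, inner_smul_right, inner_smul_right,
      inner_smul_right] at h3
    field_simp
    linear_combination h3

theorem polarDual_aequivAt_of_condition (H : AdaptedGerm F n) (hc : support F n c 0 ≠ 0)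
    (hN : 0 < hatN F n 0) (hL : hatL F n 0 = 0)
    (hK : fderiv ℝ (hatK F n) 0 (hatN F n 0, -hatM F n 0) ≠ 0) :
    AEquivAt (polarDual F n c) 0 standardCuspidalEdge 0 := by
  have hη := H.fderiv_polarDual_kernel hc hL
  have hDu := H.inner_fderiv_fderiv_polarDual_du hc hL
  obtain ⟨r, s, hs, hsη, hrel⟩ := H.exists_relation hc
  have hG := H.smooth_polarDual hc
  have hpsi := H.inner_fderiv_polarDual_psi hc
  have hdu := (H.inner_fderiv_polarDual_du hc).self_of_nhds
  have hframe := H.linearIndependent_position hc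
  set η : ℝ × ℝ := (hatN F n 0, -hatM F n 0) with hηdef
  set G := polarDual F n c with hGdef
  have hlin : ∀ q : E3, ∀ {E : Type} [NormedAddCommGroup E] [NormedSpace ℝ E] {g : E → E3} {x : E}
      (_ : SmoothNear g x) (k : ℝ), SmoothNear (fun y => inner ℝ (g y) q - k) x := fun q _ _ _ g x hg k =>
    (hg.inner (smoothNear_const q x)).sub (smoothNear_const k x)
  have hd : ∀ q : E3, ∀ {E : Type} [NormedAddCommGroup E] [NormedSpace ℝ E] {g : E → E3} {x : E}
      (_ : DifferentiableAt ℝ g x) (k : ℝ) (w : E),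
      fderiv ℝ (fun y => inner ℝ (g y) q - k) x w = inner ℝ (fderiv ℝ g x w) q := by
    intro q E _ _ g x hg k w
    rw [fderiv_sub_const, fderiv_inner_apply' hg (differentiableAt_const q)]
    simp
  -- The linear target coordinates pair with `ψ`, `F_u`, `F + c` at the origin, shifted so that
  -- `X(0) = 0`; subtracting `0` in the other two only keeps the three in the common form of `hlin`
  -- and `hd`.
  refine (aequivAt_target hG.continuousAt
    (Ψ := fun P => !₂[inner ℝ P (psi F 0) - inner ℝ (G 0) (psi F 0), inner ℝ P (du F 0) - 0,
      inner ℝ P (F 0 + c) - 0]) ?_ ?_).trans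
    (aequivAt_standard_of_coordinates (r := r) (s := s) (η := η) ?_ ?_ ?_ hs ?_ ?_ ?_ ?_ ?_ ?_ ?_)
  · exact smoothNear_vec3 (hlin _ (smoothNear_id _) _) (hlin _ (smoothNear_id _) _)
      (hlin _ (smoothNear_id _) _)
  · intro w hw
    have hΨ : SmoothNear (fun P : E3 => (!₂[inner ℝ P (psi F 0) - inner ℝ (G 0) (psi F 0),
        inner ℝ P (du F 0) - 0, inner ℝ P (F 0 + c) - 0] : E3)) (G 0) :=
      smoothNear_vec3 (hlin _ (smoothNear_id _) _) (hlin _ (smoothNear_id _) _)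
        (hlin _ (smoothNear_id _) _)
    have key : ∀ i : Fin 3, fderiv ℝ (fun P : E3 =>
        (!₂[inner ℝ P (psi F 0) - inner ℝ (G 0) (psi F 0), inner ℝ P (du F 0) - 0,
        inner ℝ P (F 0 + c) - 0] : E3) i) (G 0) w = 0 := fun i => by
      rw [fderiv_coord_apply hΨ.differentiableAt, hw]; rfl
    have k0 := key 0
    have k1 := key 1
    have k2 := key 2
    simp only [Matrix.cons_val] at k0 k1 k2
    rw [hd _ differentiableAt_fun_id] at k0 k1 k2
    simp only [fderiv_fun_id, ContinuousLinearMap.id_apply] at k0 k1 k2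
    exact eq_zero_of_inner_frame hframe k1 k0 k2
  · exact hlin _ hG _
  · exact hlin _ hG _
  · exact hlin _ hG _
  · exact sub_self _
  · filter_upwards [hrel, hG.eventually_differentiableAt] with x h1 h2
    refine ContinuousLinearMap.ext fun w => ?_
    simp only [add_apply, smul_apply, smul_eq_mul]
    rw [hd _ h2, hd _ h2, hd _ h2, h1]
  · intro h0
    have h1 := hd (psi F 0) hG.differentiableAt (inner ℝ (G 0) (psi F 0)) (0, 1)
    rw [h0, hpsi] at h1
    simp [hN.ne', hc] at h1
  · refine ContinuousLinearMap.ext fun w => ?_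
    rw [hd _ hG.differentiableAt, hdu, hL]
    simp
  · rw [hd _ hG.differentiableAt, hη, inner_zero_left]
  · have h1 : SmoothNear (fun x => inner ℝ (G x) (du F 0) - 0) 0 := hlin _ hG _
    rw [← h1.fderiv_fderiv_apply]
    have h2 : (fun x => fderiv ℝ (fun x => inner ℝ (G x) (du F 0) - 0) x η) =ᶠ[𝓝 0]
        fun x => inner ℝ (fderiv ℝ G x η) (du F 0) - 0 := by
      filter_upwards [hG.eventually_differentiableAt] with x h2
      rw [hd _ h2, sub_zero]
    rw [h2.fderiv_eq, hd _ (hG.fderiv_apply η).differentiableAt, hG.fderiv_fderiv_apply, hDu]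
    exact mul_ne_zero (neg_ne_zero.2 hK) (inv_ne_zero hc)
  · rw [hsη]
    exact neg_ne_zero.2 hN.ne'

/-- A kernel vector of `dG` exists only if `L̂ = 0`, since `N̂ ≠ 0`. If `dK(η) = 0`, then `D²G(η,
η)` is orthogonal to `F_u` and `F + c`, hence lies in the image of `dG`, which a cuspidal edge
forbids. -/
theorem condition_of_polarDual_aequivAt (H : AdaptedGerm F n) (hc : support F n c 0 ≠ 0)
    (hN : 0 < hatN F n 0) (h : AEquivAt (polarDual F n c) 0 standardCuspidalEdge 0) :
    hatL F n 0 = 0 ∧ fderiv ℝ (hatK F n) 0 (hatN F n 0, -hatM F n 0) ≠ 0 := by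
  obtain ⟨⟨ζ, hζ0, hζ⟩, -, h3⟩ := h.corank_one (H.smooth_polarDual hc)
  have hL : hatL F n 0 = 0 := by
    have h1 := (H.inner_fderiv_polarDual_du hc).self_of_nhds ζ
    have h2 := H.inner_fderiv_polarDual_psi hc ζ
    rw [hζ, inner_zero_left] at h1 h2
    by_contra hL
    simp [hL, hc] at h1
    simp [h1, hN.ne', hc] at h2
    exact hζ0 (Prod.ext h1 h2)
  refine ⟨hL, fun hK => ?_⟩
  have hη := H.fderiv_polarDual_kernel hc hL
  have hη0 : ((hatN F n 0, -hatM F n 0) : ℝ × ℝ) ≠ 0 := fun h => hN.ne' (congrArg Prod.fst h)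
  obtain ⟨w, hw⟩ := H.exists_fderiv_polarDual_eq hc hN.ne'
    (by rw [H.inner_fderiv_fderiv_polarDual_du hc hL, hK, neg_zero, zero_mul])
    (H.inner_fderiv_fderiv_polarDual_position hc hη)
  exact h3 _ hη0 hη w hw

theorem polarDual_aequivAt_iff (H : AdaptedGerm F n) (hc : support F n c 0 ≠ 0)
    (hN : 0 < hatN F n 0) :
    AEquivAt (polarDual F n c) 0 standardCuspidalEdge 0 ↔
      hatKappa₂ F n 0 = 0 ∧ ¬ IsRidgePoint F n 0 := by
  rw [H.hatKappa₂_condition_iff hN]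
  exact ⟨H.condition_of_polarDual_aequivAt hc hN,
    fun h => H.polarDual_aequivAt_of_condition hc hN h.1 h.2⟩

end AdaptedGerm

/-! ### Adapted coordinates -/

section Charts

variable {U : Set (ℝ × ℝ)} {f ν : ℝ × ℝ → E3} {p : ℝ × ℝ}
  {φ : OpenPartialHomeomorph (ℝ × ℝ) (ℝ × ℝ)}

/-- An adapted coordinate system without the sign condition on `N̂`. -/
structure IsPreAdapted (U : Set (ℝ × ℝ)) (f : ℝ × ℝ → E3) (p : ℝ × ℝ)
    (φ : OpenPartialHomeomorph (ℝ × ℝ) (ℝ × ℝ)) : Prop where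
  diffeo : IsSmoothDiffeo φ
  target_subset : φ.target ⊆ U
  zero_mem : (0 : ℝ × ℝ) ∈ φ.source
  map_zero : φ 0 = p
  singular_iff : ∀ x ∈ φ.source, IsSingularPoint (f ∘ φ) x ↔ x.2 = 0
  null : ∀ x ∈ φ.source, x.2 = 0 → dv (f ∘ φ) x = 0

theorem IsAdapted.isPreAdapted (h : IsAdapted U f ν p φ) : IsPreAdapted U f p φ :=
  ⟨h.diffeo, h.target_subset, h.zero_mem, h.map_zero, h.singular_iff, h.null⟩

theorem IsPreAdapted.mem (h : IsPreAdapted U f p φ) {x : ℝ × ℝ} (hx : x ∈ φ.source) : φ x ∈ U :=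
  h.target_subset (φ.map_source hx)

theorem IsPreAdapted.aequivAt (h : IsPreAdapted U f p φ) (g : ℝ × ℝ → E3) :
    AEquivAt g p (fun x => g (φ x)) 0 :=
  aequivAt_source g (h.diffeo.smoothNear h.zero_mem) h.map_zero
    fun _ => h.diffeo.fderiv_eq_zero_imp h.zero_mem

theorem IsPreAdapted.smoothNear_comp (h : IsPreAdapted U f p φ) (hU : IsOpen U)
    {E : Type*} [NormedAddCommGroup E] [NormedSpace ℝ E] {g : ℝ × ℝ → E}
    (hg : ContDiffOn ℝ ∞ g U) {x : ℝ × ℝ} (hx : x ∈ φ.source) : SmoothNear (g ∘ φ) x :=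
  SmoothNear.comp (g := g) (smoothNear_of_contDiffOn hg hU (h.mem hx)) (h.diffeo.smoothNear hx)

theorem IsPreAdapted.fderiv_comp (h : IsPreAdapted U f p φ) (hU : IsOpen U)
    {E : Type*} [NormedAddCommGroup E] [NormedSpace ℝ E] {g : ℝ × ℝ → E}
    (hg : ContDiffOn ℝ ∞ g U) {x : ℝ × ℝ} (hx : x ∈ φ.source) (w : ℝ × ℝ) :
    fderiv ℝ (g ∘ φ) x w = fderiv ℝ g (φ x) (fderiv ℝ φ x w) := by
  have h1 := (smoothNear_of_contDiffOn hg hU (h.mem hx)).differentiableAt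
  have h2 := (h.diffeo.smoothNear hx).differentiableAt
  rw [_root_.fderiv_comp x h1 h2]
  rfl

theorem IsPreAdapted.adaptedGerm (h : IsPreAdapted U f p φ) (hU : IsOpen U)
    (hf : IsFrontOn U f ν) (hce : HasCuspidalEdgeAt f p) : AdaptedGerm (f ∘ φ) (ν ∘ φ) := by
  have hsrc := φ.open_source.mem_nhds h.zero_mem
  have hF := h.smoothNear_comp hU hf.smooth h.zero_mem
  have hA : AEquivAt (f ∘ φ) 0 standardCuspidalEdge 0 := (h.aequivAt f).symm.trans hce
  obtain ⟨-, hne, h3⟩ := hA.corank_one hF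
  have hdv : fderiv ℝ (f ∘ φ) 0 (0, 1) = 0 := h.null 0 h.zero_mem rfl
  refine ⟨hF, h.smoothNear_comp hU hf.smooth_normal h.zero_mem, ?_, ?_, ?_, ?_, ?_⟩
  · filter_upwards [hsrc] with x hx using hf.norm_normal _ (h.mem hx)
  · filter_upwards [hsrc] with x hx w
    rw [h.fderiv_comp hU hf.smooth hx]
    exact hf.orthogonal _ (h.mem hx) _
  · exact eventually_axis (P := fun x => x.2 = 0 → dv (f ∘ φ) x = 0)
      (Filter.mem_of_superset hsrc fun x hx => h.null x hx) |>.mono fun x hx => hx rfl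
  · intro h0
    apply hne
    refine ContinuousLinearMap.ext fun w => ?_
    have e : w = w.1 • ((1 : ℝ), (0 : ℝ)) + w.2 • ((0 : ℝ), (1 : ℝ)) := by simp
    have h0' : fderiv ℝ (f ∘ φ) 0 (1, 0) = 0 := h0
    rw [e, map_add, map_smul, map_smul, h0', hdv]
    simp
  · intro t ht
    have h4 : dv (dv (f ∘ φ)) 0 = fderiv ℝ (fderiv ℝ (f ∘ φ)) 0 (0, 1) (0, 1) :=
      hF.fderiv_fderiv_apply (0, 1) (0, 1)
    refine h3 (0, 1) (by simp) hdv (t • (1, 0)) ?_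
    rw [← h4, ht, map_smul]
    rfl

/-- On the null direction `df` vanishes, so the immersion `(f, ν)` must move through `ν`. This is
what makes `N̂` nonzero. -/
theorem IsPreAdapted.dv_normal_ne_zero (h : IsPreAdapted U f p φ) (hU : IsOpen U)
    (hf : IsFrontOn U f ν) : dv (ν ∘ φ) 0 ≠ 0 := by
  intro h0
  have hdv : dv (f ∘ φ) 0 = 0 := h.null 0 h.zero_mem rfl
  have hm := h.mem h.zero_mem
  rw [dv, h.fderiv_comp hU hf.smooth h.zero_mem] at hdv
  rw [dv, h.fderiv_comp hU hf.smooth_normal h.zero_mem] at h0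
  have h1 := (smoothNear_of_contDiffOn hf.smooth hU hm).differentiableAt
  have h2 := (smoothNear_of_contDiffOn hf.smooth_normal hU hm).differentiableAt
  have h3 := (injective_iff_map_eq_zero _).1 (hf.immersion _ hm) (fderiv ℝ φ 0 (0, 1)) (by
    rw [DifferentiableAt.fderiv_prodMk h1 h2, ContinuousLinearMap.prod_apply, hdv, h0]
    rfl)
  have h4 := h.diffeo.fderiv_eq_zero_imp h.zero_mem h3
  simp at h4

theorem fderiv_standardCuspidalEdge_apply (x w : ℝ × ℝ) :
    fderiv ℝ standardCuspidalEdge x w = !₂[w.1, 2 * x.2 * w.2, 3 * x.2 ^ 2 * w.2] := by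
  have hs : SmoothNear standardCuspidalEdge x :=
    smoothNear_vec3 smoothNear_fst (smoothNear_snd.pow 2) (smoothNear_snd.pow 3)
  have hc := fderiv_coord_apply hs.differentiableAt
  refine vec3_ext ?_ ?_ ?_
  · rw [← hc]; simp [standardCuspidalEdge, fderiv_fst]
  · rw [← hc]
    simp only [standardCuspidalEdge, Matrix.cons_val]
    rw [fderiv_fun_pow 2 differentiableAt_snd, fderiv_snd]
    simp
  · rw [← hc]
    simp only [standardCuspidalEdge, Matrix.cons_val]
    rw [fderiv_fun_pow 3 differentiableAt_snd, fderiv_snd]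
    simp

/-- The source coordinates of the normal form are adapted: the target diffeomorphism does not change
the kernel of the differential, and for `(u, v², v³)` this kernel is nonzero exactly on `v = 0`,
where it contains `∂_v`. -/
theorem exists_isPreAdapted (hU : IsOpen U) (hf : ContDiffOn ℝ ∞ f U) (hp : p ∈ U)
    (hce : HasCuspidalEdgeAt f p) : ∃ φ, IsPreAdapted U f p φ := by
  obtain ⟨Φs, Φt, hs, ht, hps, hp0, -, -, hev⟩ := hce
  obtain ⟨V, hV, hVo, hpV⟩ := eventually_nhds_iff.1 hev
  set Ψ := Φs.restrOpen (U ∩ V) (hU.inter hVo) with hΨ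
  have hdiffeo : IsSmoothDiffeo Ψ.symm := (hs.restrOpen _ _).symm
  have hmem : ∀ y ∈ Ψ.symm.source, Ψ.symm y ∈ Φs.source ∩ (U ∩ V) := fun y hy => Ψ.map_target hy
  have hright : ∀ y ∈ Ψ.symm.source, Φs (Ψ.symm y) = y := fun y hy => Ψ.right_inv hy
  have key : ∀ y ∈ Ψ.symm.source, ∀ w,
      fderiv ℝ Φt (f (Ψ.symm y)) (fderiv ℝ (f ∘ Ψ.symm) y w)
        = fderiv ℝ standardCuspidalEdge y w := fun y hy w => by
    have hm := hmem y hy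
    have h1 : SmoothNear (f ∘ Ψ.symm) y :=
      SmoothNear.comp (g := f) (smoothNear_of_contDiffOn hf hU hm.2.1) (hdiffeo.smoothNear hy)
    have h2 := (ht.smoothNear (hV _ hm.2.2).1).differentiableAt.hasFDerivAt.comp y
      (h1.differentiableAt.hasFDerivAt)
    have h3 : Φt ∘ (f ∘ Ψ.symm) =ᶠ[𝓝 y] standardCuspidalEdge := by
      filter_upwards [Ψ.symm.open_source.mem_nhds hy] with z hz
      have h4 := (hV _ (hmem z hz).2.2).2
      rwa [hright z hz] at h4
    rw [← h3.fderiv_eq, h2.fderiv]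
    rfl
  have hzero : ∀ y ∈ Ψ.symm.source, ∀ w, fderiv ℝ (f ∘ Ψ.symm) y w = 0 ↔
      fderiv ℝ standardCuspidalEdge y w = 0 := fun y hy w => by
    rw [← key y hy]
    exact ⟨fun h => by rw [h, map_zero],
      fun h => ht.fderiv_eq_zero_imp (hV _ (hmem y hy).2.2).1 h⟩
  have h0 : (0 : ℝ × ℝ) ∈ Ψ.symm.source := by
    have := Ψ.map_source (show p ∈ Ψ.source from ⟨hps, hp, hpV⟩)
    rwa [show Ψ p = 0 from hp0] at this
  have hnull : ∀ y ∈ Ψ.symm.source, y.2 = 0 → fderiv ℝ (f ∘ Ψ.symm) y (0, 1) = 0 :=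
    fun y hy hy0 => by
      rw [hzero y hy, fderiv_standardCuspidalEdge_apply, hy0]
      exact vec3_ext (by simp) (by simp) (by simp)
  refine ⟨Ψ.symm, hdiffeo, fun x hx => hx.2.1, h0, ?_, fun y hy => ⟨fun hsing => ?_, fun hy0 hinj => ?_⟩,
    hnull⟩
  · have := Ψ.left_inv (show p ∈ Ψ.source from ⟨hps, hp, hpV⟩)
    rwa [show Ψ p = 0 from hp0] at this
  · by_contra hy0
    refine hsing ((injective_iff_map_eq_zero _).2 fun w hw => ?_)
    rw [hzero y hy, fderiv_standardCuspidalEdge_apply] at hw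
    have e0 := congrArg (fun P : E3 => P 0) hw
    have e1 := congrArg (fun P : E3 => P 1) hw
    simp [hy0] at e0 e1
    exact Prod.ext e0 e1
  · have := (injective_iff_map_eq_zero _).1 hinj (0, 1) (hnull y hy hy0)
    simp at this

/-- The reflection `(u, v) ↦ (u, -v)`. -/
def reflection : (ℝ × ℝ) ≃L[ℝ] (ℝ × ℝ) :=
  (ContinuousLinearEquiv.refl ℝ ℝ).prodCongr (ContinuousLinearEquiv.neg ℝ)

theorem reflection_apply (x : ℝ × ℝ) : reflection x = (x.1, -x.2) := rfl

theorem IsPreAdapted.reflect (h : IsPreAdapted U f p φ) :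
    IsPreAdapted U f p (reflection.toHomeomorph.toOpenPartialHomeomorph.trans φ) := by
  have hρ : IsSmoothDiffeo reflection.toHomeomorph.toOpenPartialHomeomorph :=
    ⟨reflection.contDiff.contDiffOn, reflection.symm.contDiff.contDiffOn⟩
  have hcomp : f ∘ (reflection.toHomeomorph.toOpenPartialHomeomorph.trans φ)
      = (f ∘ φ) ∘ reflection := rfl
  have hmem : ∀ x ∈ (reflection.toHomeomorph.toOpenPartialHomeomorph.trans φ).source,
      reflection x ∈ φ.source := fun x hx => hx.2
  refine ⟨hρ.trans h.diffeo, fun x hx => h.target_subset hx.1, ⟨mem_univ _, ?_⟩, ?_, ?_, ?_⟩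
  · change reflection 0 ∈ φ.source
    rw [_root_.map_zero]
    exact h.zero_mem
  · change φ (reflection 0) = p
    rw [_root_.map_zero]
    exact h.map_zero
  · intro x hx
    have h1 := h.singular_iff _ (hmem x hx)
    rw [IsSingularPoint] at h1 ⊢
    rw [hcomp, reflection.comp_right_fderiv, ContinuousLinearMap.coe_comp,
      ContinuousLinearEquiv.coe_coe, Function.Injective.of_comp_iff' _ reflection.bijective, h1, reflection_apply, neg_eq_zero]
  · intro x hx hx0
    have h1 : fderiv ℝ (f ∘ φ) (reflection x) (0, 1) = 0 :=
      h.null _ (hmem x hx) (by rw [reflection_apply]; simpa using hx0)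
    have e : reflection (0, 1) = -((0 : ℝ), (1 : ℝ)) := by simp [reflection_apply]
    rw [hcomp, dv, reflection.comp_right_fderiv, ContinuousLinearMap.comp_apply,
      ContinuousLinearEquiv.coe_coe, e, map_neg, h1, neg_zero]

/-- At the origin `ψ = F_vv` is unchanged by `v ↦ -v` while `n_v` changes sign; the sign of `N̂` can
therefore be chosen. -/
theorem hatN_reflect {F n : ℝ × ℝ → E3} (hF : SmoothNear F 0) (hn : SmoothNear n 0) :
    hatN (F ∘ reflection) (n ∘ reflection) 0 = -hatN F n 0 := by
  have e0 : (((0 : ℝ × ℝ).1, -(0 : ℝ × ℝ).2) : ℝ × ℝ) = 0 := by simp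
  have h1 : dv (F ∘ reflection) =ᶠ[𝓝 0] fun x => -dv F (x.1, -x.2) :=
    (eventually_reflect hF.eventually_differentiableAt).mono fun x hx => dv_reflect hx
  have h2 : dv (dv (F ∘ reflection)) 0 = dv (dv F) 0 := by
    have h3 := dv_reflect (s := fun x => -dv F x) (x := 0)
      (by rw [e0]; exact hF.smoothNear_dv.neg.differentiableAt)
    rw [e0] at h3
    rw [(eventuallyEq_dv h1).self_of_nhds, h3, dv, fderiv_fun_neg]
    simp [dv]
  have h4 : dv (n ∘ reflection) 0 = -dv n 0 := by
    have h5 := dv_reflect (s := n) (x := 0) (by rw [e0]; exact hn.differentiableAt)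
    rw [e0] at h5
    exact h5
  rw [hatN, hatN, AdaptedGerm.psi_zero, AdaptedGerm.psi_zero, h2, h4, inner_neg_right]

theorem IsPreAdapted.exists_isAdapted (h : IsPreAdapted U f p φ) (hU : IsOpen U)
    (hf : IsFrontOn U f ν) (hN : 0 < hatN (f ∘ φ) (ν ∘ φ) 0) : ∃ φ', IsAdapted U f ν p φ' := by
  -- This function agrees with `N̂` on the axis and is continuous, so positivity at the origin
  -- persists on a smaller chart.
  have hs : SmoothNear (fun x => -inner ℝ (dv (dv (f ∘ φ)) x) (dv (ν ∘ φ) x)) 0 :=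
    ((h.smoothNear_comp hU hf.smooth h.zero_mem).smoothNear_dv.smoothNear_dv.inner
      (h.smoothNear_comp hU hf.smooth_normal h.zero_mem).smoothNear_dv).neg
  have h0 : 0 < -inner ℝ (dv (dv (f ∘ φ)) 0) (dv (ν ∘ φ) 0) := by
    rwa [hatN, AdaptedGerm.psi_zero] at hN
  obtain ⟨s, hpos, hso, hs0⟩ := eventually_nhds_iff.1 (hs.continuousAt.eventually (lt_mem_nhds h0))
  refine ⟨φ.restrOpen s hso, h.diffeo.restrOpen s hso, fun x hx => h.target_subset hx.1,
    ⟨h.zero_mem, hs0⟩, h.map_zero, fun x hx => h.singular_iff x hx.1, fun x hx => h.null x hx.1,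
    fun x hx hx0 => ?_⟩
  change 0 < hatN (f ∘ φ) (ν ∘ φ) x
  rw [hatN, psi, if_pos hx0]
  exact hpos x hx.2

theorem exists_isAdapted (hU : IsOpen U) (hf : IsFrontOn U f ν) (hp : p ∈ U)
    (hce : HasCuspidalEdgeAt f p) : ∃ φ, IsAdapted U f ν p φ := by
  obtain ⟨φ, hφ⟩ := exists_isPreAdapted hU hf.smooth hp hce
  have hne := (hφ.adaptedGerm hU hf hce).hatN_ne_zero (hφ.dv_normal_ne_zero hU hf)
  rcases lt_or_gt_of_ne hne with h | h
  · refine hφ.reflect.exists_isAdapted hU hf ?_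
    change 0 < hatN ((f ∘ φ) ∘ reflection) ((ν ∘ φ) ∘ reflection) 0
    rw [hatN_reflect (hφ.smoothNear_comp hU hf.smooth hφ.zero_mem)
      (hφ.smoothNear_comp hU hf.smooth_normal hφ.zero_mem)]
    linarith
  · exact hφ.exists_isAdapted hU hf h

end Charts

/-! ### The dual surface and its inversion -/

/-- The inversion in the unit sphere. -/
def inversion (P : E3) : E3 := (inner ℝ P P : ℝ)⁻¹ • P

theorem smoothNear_inversion {P : E3} (hP : P ≠ 0) : SmoothNear inversion P := by
  have h1 : SmoothNear (fun P : E3 => 1 / (inner ℝ P P : ℝ)) P :=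
    (smoothNear_const 1 P).div ((smoothNear_id P).inner (smoothNear_id P))
      (inner_self_ne_zero.2 hP)
  exact (h1.smul (smoothNear_id P)).congr (Eventually.of_forall fun x => by
    simp only [inversion, one_div])

theorem inversion_inversion {P : E3} (hP : P ≠ 0) : inversion (inversion P) = P := by
  have h : (inner ℝ P P : ℝ) ≠ 0 := inner_self_ne_zero.2 hP
  simp only [inversion, inner_smul_left, inner_smul_right, smul_smul, RCLike.conj_to_real]
  have : ((inner ℝ P P : ℝ)⁻¹ * ((inner ℝ P P : ℝ)⁻¹ * inner ℝ P P))⁻¹ * (inner ℝ P P : ℝ)⁻¹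
      = 1 := by field_simp
  rw [this, one_smul]

theorem aequivAt_inversion {g : ℝ × ℝ → E3} {p : ℝ × ℝ} (hg : ContinuousAt g p) (h0 : g p ≠ 0) :
    AEquivAt g p (fun x => inversion (g x)) p := by
  have h1 : inversion (g p) ≠ 0 := fun h => h0 (by
    have := inversion_inversion h0
    rw [h] at this
    simpa [inversion] using this.symm)
  refine aequivAt_target_of_leftInverse hg (Ψ' := inversion) (smoothNear_inversion h0)
    (smoothNear_inversion h1).differentiableAt ?_
  filter_upwards [isOpen_ne.mem_nhds h0] with P hP using inversion_inversion hP

theorem AdaptedGerm.aequivAt_polarDual {F n : ℝ × ℝ → E3} {c : E3} (H : AdaptedGerm F n)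
    (hc : support F n c 0 ≠ 0) :
    AEquivAt (fun x => support F n c x • n x) 0 (polarDual F n c) 0 := by
  have hs : SmoothNear (fun x => support F n c x • n x) 0 :=
    (H.smooth_support c).smul H.smooth_normal
  have hn : n 0 ≠ 0 := fun h => by
    have := H.norm_normal.self_of_nhds
    simp [h] at this
  refine (aequivAt_inversion hs.continuousAt (smul_ne_zero hc hn)).trans
    (aequivAt_of_eventuallyEq ?_)
  filter_upwards [H.norm_normal, (H.smooth_support c).continuousAt.eventually_ne hc] with x h1 h2
  have h3 : inner ℝ (n x) (n x) = (1 : ℝ) := by rw [real_inner_self_eq_norm_sq, h1]; norm_num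
  rw [inversion, polarDual, inner_smul_left, inner_smul_right, h3, smul_smul]
  congr 1
  simp only [RCLike.conj_to_real]
  field_simp

end CuspidalEdge

end

/-! ### The main theorem, by passing to an adapted chart and then to the polar dual. -/

theorem proposition4p2 (U : Set (ℝ × ℝ)) (hU : IsOpen U) (f ν : ℝ × ℝ → CuspidalEdge.E3)
    (hf : CuspidalEdge.IsFrontOn U f ν) (p : ℝ × ℝ) (hp : p ∈ U)
    (hce : CuspidalEdge.HasCuspidalEdgeAt f p)
    (c : CuspidalEdge.E3) (hc : inner ℝ (f p + c) (ν p) ≠ 0) :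
    (∃ φ : OpenPartialHomeomorph (ℝ × ℝ) (ℝ × ℝ), CuspidalEdge.IsAdapted U f ν p φ) ∧
    ∀ φ : OpenPartialHomeomorph (ℝ × ℝ) (ℝ × ℝ), CuspidalEdge.IsAdapted U f ν p φ →
      (CuspidalEdge.HasCuspidalEdgeAt (CuspidalEdge.dualSurface f ν c) p ↔
        CuspidalEdge.hatKappa₂ (f ∘ φ) (ν ∘ φ) 0 = 0 ∧
          ¬ CuspidalEdge.IsRidgePoint (f ∘ φ) (ν ∘ φ) 0) := by
  refine ⟨CuspidalEdge.exists_isAdapted hU hf hp hce, fun φ hφ => ?_⟩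
  have hpre := hφ.isPreAdapted
  have H := hpre.adaptedGerm hU hf hce
  have hc0 : CuspidalEdge.support (f ∘ φ) (ν ∘ φ) c 0 ≠ 0 := by
    simpa [CuspidalEdge.support, hφ.map_zero] using hc
  rw [← H.polarDual_aequivAt_iff hc0 (hφ.hatN_pos 0 hφ.zero_mem rfl)]
  have h : CuspidalEdge.AEquivAt (CuspidalEdge.dualSurface f ν c) p
      (CuspidalEdge.polarDual (f ∘ φ) (ν ∘ φ) c) 0 :=
    (hpre.aequivAt _).trans (H.aequivAt_polarDual hc0)
  exact ⟨fun h' => h.symm.trans h', fun h' => h.trans h'⟩
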